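/- Let $(W,S)$ be a finite Coxeter group with length function $l$, and let $\mathbf I=\{w\in W : w^2=1\}$. Let $\mathcal H(W)$ be the one-parameter Iwahori–Hecke algebra of $W$ over $\mathbb Q[v^{\pm1}]$ with parameter $v^2$, i.e. the associative unital algebra with generators $T_s$ ($s\in S$) subject to the braid relations and the quadratic relations $(T_s-v^2)(T_s+1)=0$. Let $\sigma$ be an automorphism of the group $W$ with $\sigma(S)=S$, of order $d$, and let $\tilde{\mathcal H}(W)$ be the extended Hecke algebra, i.e. the associative $\mathbb Q[v^{\pm1}]$-algebra generated by $\mathcal H(W)$ together with an additional element $T_\sigma$ subject to the relations $T_\sigma^d=1$ and $T_\sigma T_s=T_{\sigma(s)}T_\sigma$ for all $s\in S$. There is a unique representation $R_v$ of $\mathcal H(W)$ (Lusztig's representation) on the free $\mathbb Q[v^{\pm1}]$-module with basis $\{a_w : w\in\mathbf I\}$ such that, for all $s\in S$ and $w\in\mathbf I$, $$T_s.a_w=\begin{cases} v\,a_w+(v+1)a_{sw}& \text{if }sw=ws,\ l(ws)>l(w),\\ (v^2-v-1)a_w+(v^2-v)a_{sw}& \text{if }sw=ws,\ l(ws)<l(w),\\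 a_{sws}& \text{if }sw\ne ws,\ l(ws)>l(w),\\ (v^2-1)a_w+v^2a_{sws}& \text{if }sw\ne ws,\ l(ws)<l(w).\end{cases}$$ Moreover, $R_v$ extends to a representation $\tilde R_v$ of $\tilde{\mathcal H}(W)$ on the same module, that is, composing $\tilde R_v$ with the canonical homomorphism $\mathcal H(W)\to\tilde{\mathcal H}(W)$ gives $R_v$, via $$T_\sigma.a_w=a_{\sigma(w)}\qquad\text{for all }w\in\mathbf I,$$ and $\tilde R_v$ is the only such extension. -/

import Mathlib

namespace TwistedInvolution

noncomputable section

/-- The ground ring `ℚ[v, v⁻¹]`. -/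
abbrev Scalars : Type := LaurentPolynomial ℚ

/-- The indeterminate `v`. -/
def v : Scalars := LaurentPolynomial.T 1

section Hecke

variable {B : Type*} (M : CoxeterMatrix B)

/-- The defining relations of the Iwahori–Hecke algebra with parameter `v ^ 2`, between
polynomials in free generators `T_i`, `i ∈ B`: the quadratic relations
`(T_i - v ^ 2) (T_i + 1) = 0` and the braid relations
`T_i T_j T_i ⋯ = T_j T_i T_j ⋯` with `M i j` factors on each side. -/
inductive HeckeRel : FreeAlgebra Scalars B → FreeAlgebra Scalars B → Prop
  | quadratic (i : B) :
      HeckeRel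
        ((FreeAlgebra.ι Scalars i - algebraMap Scalars (FreeAlgebra Scalars B) (v ^ 2)) *
          (FreeAlgebra.ι Scalars i + 1))
        0
  | braid (i j : B) :
      HeckeRel
        ((CoxeterSystem.braidWord M i j).map (FreeAlgebra.ι Scalars)).prod
        ((CoxeterSystem.braidWord M j i).map (FreeAlgebra.ι Scalars)).prod

/-- The one-parameter Iwahori–Hecke algebra `H(W)` over `ℚ[v, v⁻¹]` with parameter `v ^ 2`
of the Coxeter group with Coxeter matrix `M`. -/
abbrev Hecke := RingQuot (HeckeRel M)

/-- The standard generator `T_s` for the simple reflection `s = s_i`. -/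
def Hecke.T (i : B) : Hecke M :=
  RingQuot.mkAlgHom Scalars (HeckeRel M) (FreeAlgebra.ι Scalars i)

variable {M} {W : Type*} [Group W] (cs : CoxeterSystem M W) (σ : MulAut W)

/-- The defining relations of the extended Hecke algebra. The free generators are one symbol
`some h` for each `h ∈ H(W)`, and the additional symbol `none`, which stands for `T_σ`.
The first three families of relations say that `h ↦ some h` is a homomorphism of
`ℚ[v, v⁻¹]`-algebras; the others are `T_σ ^ d = 1`, where `d` is the order of `σ`, and
`T_σ T_s = T_{σ(s)} T_σ` for each simple reflection `s`. -/
inductive ExtendedHeckeRel :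
    FreeAlgebra Scalars (Option (Hecke M)) → FreeAlgebra Scalars (Option (Hecke M)) → Prop
  | add (x y : Hecke M) :
      ExtendedHeckeRel
        (FreeAlgebra.ι Scalars (some (x + y)))
        (FreeAlgebra.ι Scalars (some x) + FreeAlgebra.ι Scalars (some y))
  | mul (x y : Hecke M) :
      ExtendedHeckeRel
        (FreeAlgebra.ι Scalars (some (x * y)))
        (FreeAlgebra.ι Scalars (some x) * FreeAlgebra.ι Scalars (some y))
  | scalar (r : Scalars) :
      ExtendedHeckeRel
        (FreeAlgebra.ι Scalars (some (algebraMap Scalars (Hecke M) r)))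
        (algebraMap Scalars (FreeAlgebra Scalars (Option (Hecke M))) r)
  | sigma_pow :
      ExtendedHeckeRel (FreeAlgebra.ι Scalars none ^ orderOf σ) 1
  | sigma_simple (i j : B) (h : σ (cs.simple i) = cs.simple j) :
      ExtendedHeckeRel
        (FreeAlgebra.ι Scalars none * FreeAlgebra.ι Scalars (some (Hecke.T M i)))
        (FreeAlgebra.ι Scalars (some (Hecke.T M j)) * FreeAlgebra.ι Scalars none)

/-- The extended Hecke algebra: the associative `ℚ[v, v⁻¹]`-algebra generated by `H(W)`
together with an element `T_σ`, subject to `T_σ ^ d = 1` and `T_σ T_s = T_{σ(s)} T_σ`. -/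
abbrev ExtendedHecke := RingQuot (ExtendedHeckeRel cs σ)

/-- The additional generator `T_σ`. -/
def ExtendedHecke.Tσ : ExtendedHecke cs σ :=
  RingQuot.mkAlgHom Scalars (ExtendedHeckeRel cs σ) (FreeAlgebra.ι Scalars none)

/-- The structural homomorphism from `H(W)` to the extended Hecke algebra. -/
def ExtendedHecke.incl : Hecke M →ₐ[Scalars] ExtendedHecke cs σ :=
  AlgHom.ofLinearMap
    { toFun := fun x =>
        RingQuot.mkAlgHom Scalars (ExtendedHeckeRel cs σ) (FreeAlgebra.ι Scalars (some x))
      map_add' := fun x y => by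
        rw [RingQuot.mkAlgHom_rel Scalars (ExtendedHeckeRel.add x y), map_add]
      map_smul' := fun r x => by
        rw [Algebra.smul_def, RingQuot.mkAlgHom_rel Scalars (ExtendedHeckeRel.mul _ x), map_mul,
          RingQuot.mkAlgHom_rel Scalars (ExtendedHeckeRel.scalar r), AlgHom.commutes,
          RingHom.id_apply, Algebra.smul_def] }
    (by
      have h := RingQuot.mkAlgHom_rel Scalars
        (ExtendedHeckeRel.scalar (cs := cs) (σ := σ) (1 : Scalars))
      rw [map_one, map_one, map_one] at h
      exact h)
    (fun x y => by
      have h := RingQuot.mkAlgHom_rel Scalars (ExtendedHeckeRel.mul (cs := cs) (σ := σ) x y)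
      rw [map_mul] at h
      exact h)

end Hecke

section Module

variable (W : Type*) [Group W]

/-- The set `I = {w ∈ W : w ^ 2 = 1}`. -/
abbrev Involutions := {w : W // w ^ 2 = 1}

/-- The free `ℚ[v, v⁻¹]`-module with basis `a_w`, `w ∈ I`. -/
abbrev InvModule := Involutions W →₀ Scalars

variable {W}

/-- The basis vector `a_w`. -/
def a (w : Involutions W) : InvModule W := Finsupp.single w 1

/-- The action of an automorphism of `W` on `I`. -/
def autInv (σ : MulAut W) (w : Involutions W) : Involutions W :=
  ⟨σ w.1, by rw [← map_pow, w.2, map_one]⟩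

variable {B : Type*} {M : CoxeterMatrix B} (cs : CoxeterSystem M W)

/-- The element `s w` of `I`, where `s = s_i` commutes with `w`. -/
def mulInv (i : B) (w : Involutions W) (h : cs.simple i * w.1 = w.1 * cs.simple i) :
    Involutions W :=
  ⟨cs.simple i * w.1, by
    have hc : Commute (cs.simple i) w.1 := h
    rw [hc.mul_pow, w.2, cs.simple_sq, one_mul]⟩

/-- The element `s w s` of `I`, where `s = s_i`. -/
def conjInv (i : B) (w : Involutions W) : Involutions W :=
  ⟨cs.simple i * w.1 * cs.simple i, by
    have h := w.2
    rw [pow_two] at h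
    calc (cs.simple i * w.1 * cs.simple i) ^ 2
        = cs.simple i * w.1 * (cs.simple i * cs.simple i) * w.1 * cs.simple i := by
          rw [pow_two]; simp only [mul_assoc]
      _ = 1 := by
          rw [cs.simple_mul_simple_self, mul_one, mul_assoc (cs.simple i), h, mul_one,
            cs.simple_mul_simple_self]⟩

open Classical in
/-- The right hand side of Lusztig's formula for `T_s . a_w`, where `s = s_i`. The alternative
to `ℓ(w s) > ℓ(w)` is `ℓ(w s) < ℓ(w)`, as these two lengths always differ. -/
def lusztigFormula (i : B) (w : Involutions W) : InvModule W :=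
  if h : cs.simple i * w.1 = w.1 * cs.simple i then
    if cs.length (w.1 * cs.simple i) > cs.length w.1 then
      v • a w + (v + 1) • a (mulInv cs i w h)
    else
      (v ^ 2 - v - 1) • a w + (v ^ 2 - v) • a (mulInv cs i w h)
  else
    if cs.length (w.1 * cs.simple i) > cs.length w.1 then
      a (conjInv cs i w)
    else
      (v ^ 2 - 1) • a w + v ^ 2 • a (conjInv cs i w)

/-- `R` is Lusztig's representation `R_v` of `H(W)` on the free module with basis `a_w`,
`w ∈ I`: each `T_s` acts by Lusztig's formula. -/
def IsLusztigRep (R : Hecke M →ₐ[Scalars] Module.End Scalars (InvModule W)) : Prop :=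
  ∀ (i : B) (w : Involutions W), R (Hecke.T M i) (a w) = lusztigFormula cs i w

end Module

end

end TwistedInvolution

namespace TwistedInvolution

/-! ### The inversion cocycle of a Coxeter group, with values mod 2. -/

section Inversions

/-! Both algebras are given by generators and relations, so each uniqueness claim follows from
agreement on generators, and each existence claim reduces to checking relations on the operators
`lusztigOp` and `sigmaOp`. The quadratic relation holds on the span of each pair {a_u, a_{su}} or
{a_u, a_{sus}} (`lusztigOp_mul_self`). The relations involving σ hold because σ preserves length
(`sigmaOp_mul_lusztigOp`). The substance is the braid relation (`lusztigOp_braid`).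

Let s, t be simple reflections with st of finite order m, and let W_J be the subgroup they generate.
Write P_k, Q_k for the two alternating products of k operators. By the quadratic relations, the
vectors on which P_m and Q_m agree form a submodule stable under T_s and T_t. If w has s or t as a
descent, a_w is therefore reached from a shorter involution, up to cancelling v + 1
(`lusztigOp_braid_of_descent`). Induction on length leaves an involution z with neither descent;
such a z has no inversion among the reflections of W_J.

The orbit of such a z depends on which reflections of W_J are conjugated by z into W_J. By
`conj_simple_eq_of_isDihedralReflection` and `conj_simple_cases`, only four situations occur up to
exchanging s and t: no reflection; exactly one, which is simple and fixed by z; z centralizes W_J; z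
exchanges s and t. In the first two, both products are computed outright.

In the last two, put D_k = (P_k - Q_k) a_z. Then D_0 = 0 and D_{k+2} = S D_{k+1} - v² D_k for a
fixed operator S. The D_k are computed only up to k about m/2, where the two halves of the orbit
meet. A proportionality between the middle terms is then propagated outwards by the recurrence until
it reads D_m = c D_0 = 0 (`reflected_sequence_eq_zero`).

All descent conditions are handled by `inversionSign`, a cocycle on W that detects left inversions.
-/

theorem endMul_apply {α : Type*} (f g : Function.End α) (x : α) : (f * g) x = f (g x) := rfl

variable {B : Type*} {M : CoxeterMatrix B} {W : Type*} [Group W] (cs : CoxeterSystem M W)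

open Classical in
/-- The action of a simple reflection on signed group elements. -/
noncomputable def signedConj (i : B) : Function.End (W × ZMod 2) := fun p =>
  (cs.simple i * p.1 * cs.simple i, p.2 + if p.1 = cs.simple i then 1 else 0)

open Classical in
theorem signedConj_mul_pow (i j : B) (k : ℕ) (τ : W) (ε : ZMod 2) :
    ((signedConj cs i * signedConj cs j) ^ k) (τ, ε) =
      ((cs.simple i * cs.simple j) ^ k * τ * ((cs.simple i * cs.simple j) ^ k)⁻¹,
        ε + ∑ a ∈ Finset.range (2 * k),
          if (cs.simple i * cs.simple j) ^ a * τ = cs.simple j then 1 else 0) := by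
  induction k with
  | zero => simp [Function.End.one_def]
  | succ k ih =>
    set s := cs.simple i with hs
    set t := cs.simple j with ht
    have hss : s * s = 1 := cs.simple_mul_simple_self i
    have htt : t * t = 1 := cs.simple_mul_simple_self j
    have hsi : s⁻¹ = s := cs.inv_simple i
    have hti : t⁻¹ = t := cs.inv_simple j
    -- Conjugation by t inverts st. This turns each test on a conjugate of τ into a test on a left
    -- translate (st)^a τ.
    have htρ : ∀ a : ℕ, (s * t) ^ a * (t * (s * t) ^ a) = t := by
      intro a
      have h : SemiconjBy t (s * t)⁻¹ (s * t) := by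
        rw [SemiconjBy, mul_inv_rev, hsi, hti, ← mul_assoc, htt, one_mul, mul_assoc, htt, mul_one]
      have h' := h.pow_right a
      rw [SemiconjBy, inv_pow, mul_inv_eq_iff_eq_mul, mul_assoc] at h'
      exact h'.symm
    rw [pow_succ', endMul_apply, ih]
    have e1 : ((s * t) ^ k * τ * ((s * t) ^ k)⁻¹ = t) ↔ (s * t) ^ (2 * k) * τ = t := by
      rw [mul_inv_eq_iff_eq_mul, ← mul_right_inj ((s * t) ^ k), htρ, ← mul_assoc, two_mul,
        pow_add]
    have e2 : (t * ((s * t) ^ k * τ * ((s * t) ^ k)⁻¹) * t = s) ↔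
        (s * t) ^ (2 * k + 1) * τ = t := by
      rw [← eq_mul_inv_iff_mul_eq, hti, ← eq_inv_mul_iff_mul_eq, hti, mul_inv_eq_iff_eq_mul,
        ← mul_right_inj ((s * t) ^ (k + 1)), ← mul_assoc, ← pow_add,
        show t * (s * t) * (s * t) ^ k = t * (s * t) ^ (k + 1) by rw [pow_succ', mul_assoc], htρ,
        show k + 1 + k = 2 * k + 1 by ring]
    rw [show 2 * (k + 1) = 2 * k + 1 + 1 by ring, Finset.sum_range_succ, Finset.sum_range_succ]
    simp only [endMul_apply, signedConj, ← hs, ← ht, e1, e2]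
    refine Prod.ext ?_ ?_
    · simp [pow_succ', mul_assoc, hsi, hti]
    · simp only; ring

open Classical in
-- When (st)^m = 1, the 2m tests form two identical blocks of m, which cancel mod 2.
theorem signedConj_mul_pow_eq_one {i j : B} {m : ℕ}
    (hm : (cs.simple i * cs.simple j) ^ m = 1) : (signedConj cs i * signedConj cs j) ^ m = 1 := by
  funext ⟨τ, ε⟩
  change _ = (τ, ε)
  rw [signedConj_mul_pow, hm, two_mul, Finset.sum_range_add]
  have h : ∑ x ∈ Finset.range m,
        (if (cs.simple i * cs.simple j) ^ (m + x) * τ = cs.simple j then 1 else 0 : ZMod 2) =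
      ∑ x ∈ Finset.range m,
        if (cs.simple i * cs.simple j) ^ x * τ = cs.simple j then 1 else 0 :=
    Finset.sum_congr rfl fun x _ => by rw [pow_add, hm, one_mul]
  rw [h, CharTwo.add_self_eq_zero]
  simp

theorem isLiftable_signedConj : M.IsLiftable (signedConj cs) := fun i j =>
  signedConj_mul_pow_eq_one cs (cs.simple_mul_simple_pow i j)

/-- The action of `W` on signed group elements. -/
noncomputable def signedAction : W →* Function.End (W × ZMod 2) :=
  cs.lift ⟨signedConj cs, isLiftable_signedConj cs⟩

theorem signedAction_simple (i : B) : signedAction cs (cs.simple i) = signedConj cs i :=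
  cs.lift_apply_simple _ i

theorem signedAction_apply (w τ : W) (ε : ZMod 2) :
    signedAction cs w (τ, ε) = (w * τ * w⁻¹, ε + (signedAction cs w (τ, 0)).2) := by
  induction w using cs.simple_induction_left generalizing τ ε with
  | one => simp [Function.End.one_def]
  | mul_simple_left w i ih =>
    rw [map_mul, endMul_apply, endMul_apply, ih,
      ih (ε := 0), signedAction_simple]
    simp [signedConj, mul_assoc, add_assoc]

/-- The left inversion cocycle of a Coxeter group, with values in `ℤ/2`. -/
noncomputable def inversionSign (w τ : W) : ZMod 2 := (signedAction cs w⁻¹ (τ, 0)).2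

/-- The cocycle rule behind every descent computation: τ is counted once against x and once, after
being carried through x, against y. -/
theorem inversionSign_mul (x y τ : W) :
    inversionSign cs (x * y) τ = inversionSign cs x τ + inversionSign cs y (x⁻¹ * τ * x) := by
  unfold inversionSign
  rw [mul_inv_rev, map_mul, endMul_apply, signedAction_apply,
    signedAction_apply cs x⁻¹]
  simp

@[simp] theorem inversionSign_one (τ : W) : inversionSign cs 1 τ = 0 := by
  simp [inversionSign, Function.End.one_def]

open Classical in
theorem inversionSign_simple (i : B) (τ : W) :
    inversionSign cs (cs.simple i) τ = if τ = cs.simple i then 1 else 0 := by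
  simp [inversionSign, signedAction_simple, signedConj]

theorem inversionSign_simple_self (i : B) :
    inversionSign cs (cs.simple i) (cs.simple i) = 1 := by
  simp [inversionSign_simple]

/-- For τ = x s x⁻¹ the contributions of x and x⁻¹ cancel, as they do in x x⁻¹ = 1, and the middle
letter contributes 1. -/
theorem inversionSign_self {τ : W} (hτ : cs.IsReflection τ) : inversionSign cs τ τ = 1 := by
  obtain ⟨x, i, rfl⟩ := hτ
  have h := inversionSign_mul cs x x⁻¹ (x * cs.simple i * x⁻¹)
  rw [mul_inv_cancel, inversionSign_one] at h
  rw [inversionSign_mul, inversionSign_mul]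
  simp only [mul_assoc, inv_mul_cancel_left, inv_mul_cancel, mul_one, mul_inv_rev,
    cs.inv_simple, cs.simple_mul_simple_self] at h ⊢
  rw [inversionSign_simple_self, add_right_comm, ← h, zero_add]

/-- A letter contributes at τ only if the reflection it produces is τ, so a nonzero sign places τ in
the left inversion sequence of any word for w. For a reduced word every entry of that sequence is an
inversion. -/
theorem length_mul_lt_of_inversionSign {w τ : W} (h : inversionSign cs w τ = 1) :
    cs.length (τ * w) < cs.length w := by
  have key : ∀ (ω : List B) (τ : W), inversionSign cs (cs.wordProd ω) τ ≠ 0 →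
      τ ∈ cs.leftInvSeq ω := by
    intro ω
    induction ω with
    | nil => simp
    | cons i ω ih =>
      intro τ hτ
      rw [cs.wordProd_cons, inversionSign_mul, inversionSign_simple] at hτ
      rw [CoxeterSystem.leftInvSeq, List.mem_cons, List.mem_map]
      by_cases hi : τ = cs.simple i
      · exact Or.inl hi
      · rw [if_neg hi, zero_add] at hτ
        refine Or.inr ⟨_, ih _ hτ, ?_⟩
        simp [mul_assoc]
  obtain ⟨ω, hω, rfl⟩ := cs.exists_isReduced w
  exact (cs.isLeftInversion_of_mem_leftInvSeq hω (key ω τ (by rw [h]; exact one_ne_zero))).2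

theorem inversionSign_eq_one_iff {w τ : W} (hτ : cs.IsReflection τ) :
    inversionSign cs w τ = 1 ↔ cs.length (τ * w) < cs.length w := by
  refine ⟨length_mul_lt_of_inversionSign cs, fun h => ?_⟩
  by_contra h1
  -- If τ shortened w while the sign were 0, the cocycle rule would give τw sign 1 at τ, so τ would
  -- also shorten τw.
  have h0 : inversionSign cs w τ = 0 := by
    generalize inversionSign cs w τ = x at h1
    revert x; decide
  have h2 : inversionSign cs (τ * w) τ = 1 := by
    rw [inversionSign_mul, inversionSign_self cs hτ, hτ.inv, hτ.mul_self, one_mul, h0, add_zero]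
  have h3 := length_mul_lt_of_inversionSign cs h2
  rw [← mul_assoc, hτ.mul_self, one_mul] at h3
  omega

theorem inversionSign_eq_zero_iff {w τ : W} (hτ : cs.IsReflection τ) :
    inversionSign cs w τ = 0 ↔ cs.length w < cs.length (τ * w) := by
  have h := inversionSign_eq_one_iff cs (w := w) hτ
  have hne := hτ.length_mul_right_ne w
  have h2 : ∀ x : ZMod 2, x = 0 ↔ ¬ x = 1 := by decide
  rw [h2, h]
  omega

end Inversions

/-! ### Alternating products of two elements. -/

section Alternating

variable {B : Type*} {G : Type*} [Monoid G]

/-- The `k`-th letter of the alternating sequence `i, j, i, j, …`. -/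
def letter (i j : B) (k : ℕ) : B := if Even k then i else j

@[simp] theorem letter_zero (i j : B) : letter i j 0 = i := by simp [letter]

@[simp] theorem letter_succ (i j : B) (k : ℕ) : letter i j (k + 1) = letter j i k := by
  by_cases h : Even k <;> simp [letter, h, Nat.even_add_one]

theorem letter_cases (i j : B) (k : ℕ) :
    (letter i j k = i ∧ letter j i k = j) ∨ (letter i j k = j ∧ letter j i k = i) := by
  by_cases h : Even k <;> simp [letter, h]

/-- The alternating product `⋯ f j * f i * f j * f i` with `k` factors. -/
def altProd (f : B → G) (i j : B) : ℕ → G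
  | 0 => 1
  | k + 1 => f (letter i j k) * altProd f i j k

@[simp] theorem altProd_zero (f : B → G) (i j : B) : altProd f i j 0 = 1 := rfl

theorem altProd_succ (f : B → G) (i j : B) (k : ℕ) :
    altProd f i j (k + 1) = f (letter i j k) * altProd f i j k := rfl

theorem altProd_succ' (f : B → G) (i j : B) (k : ℕ) :
    altProd f i j (k + 1) = altProd f j i k * f i := by
  induction k with
  | zero => simp [altProd_succ]
  | succ k ih => rw [altProd_succ, ih, altProd_succ f j i, letter_succ, mul_assoc]

theorem altProd_add (f : B → G) (i j : B) (m k : ℕ) :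
    altProd f i j (m + k) =
      altProd f (letter i j m) (letter j i m) k * altProd f i j m := by
  induction m generalizing i j with
  | zero => simp
  | succ m ih =>
    rw [show m + 1 + k = m + k + 1 by ring, altProd_succ', ih, altProd_succ' f i j m, mul_assoc,
      letter_succ, letter_succ]

theorem prod_map_alternatingWord (f : B → G) (i j : B) (k : ℕ) :
    ((CoxeterSystem.alternatingWord j i k).map f).prod = altProd f i j k := by
  induction k with
  | zero => simp [CoxeterSystem.alternatingWord]
  | succ k ih =>
    rw [CoxeterSystem.alternatingWord_succ', List.map_cons, List.prod_cons, ih, altProd_succ,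
      letter]

/-- This passes from the order of s_i s_j, where the braid relation is proved, to the entry `M i j`,
of which that order is a divisor. -/
theorem altProd_eq_of_dvd (f : B → G) {i j : B} {m n : ℕ} (h : altProd f i j m = altProd f j i m)
    (hmn : m ∣ n) : altProd f i j n = altProd f j i n := by
  obtain ⟨k, rfl⟩ := hmn
  induction k with
  | zero => simp
  | succ k ih =>
    rw [Nat.mul_succ, add_comm, altProd_add, altProd_add f j i, h]
    rcases letter_cases i j m with ⟨h1, h2⟩ | ⟨h1, h2⟩ <;> rw [h1, h2, ih]

end Alternating

/-! ### Rank two parabolic subgroups and their reflections. -/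

section Dihedral

variable {B : Type*} {M : CoxeterMatrix B} {W : Type*} [Group W] (cs : CoxeterSystem M W)

/-- The order of the product of two simple reflections. -/
noncomputable def simpleOrder (i j : B) : ℕ := orderOf (cs.simple i * cs.simple j)

theorem simpleOrder_comm (i j : B) : simpleOrder cs i j = simpleOrder cs j i := by
  unfold simpleOrder
  rw [← orderOf_inv, mul_inv_rev, cs.inv_simple, cs.inv_simple]

theorem simpleOrder_letter (i j : B) (k : ℕ) :
    simpleOrder cs (letter i j k) (letter j i k) = simpleOrder cs i j := by
  rcases letter_cases i j k with ⟨h1, h2⟩ | ⟨h1, h2⟩ <;> rw [h1, h2]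
  exact simpleOrder_comm cs j i

theorem inv_altProd_succ (i j : B) (k : ℕ) :
    (altProd cs.simple i j (k + 1))⁻¹ = cs.simple i * (altProd cs.simple j i k)⁻¹ := by
  rw [altProd_succ', mul_inv_rev, cs.inv_simple]

theorem inv_altProd_succ' (i j : B) (k : ℕ) :
    (altProd cs.simple i j (k + 1))⁻¹ =
      (altProd cs.simple i j k)⁻¹ * cs.simple (letter i j k) := by
  rw [altProd_succ, mul_inv_rev, cs.inv_simple]

/-- The first factor ends in s_i and the inverted second factor begins with s_j, so the
concatenation still alternates. -/
theorem altProd_mul_inv_altProd (i j : B) (a b : ℕ) :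
    altProd cs.simple i j a * (altProd cs.simple j i b)⁻¹ =
      (altProd cs.simple (letter j i a) (letter i j a) (a + b))⁻¹ := by
  induction a with
  | zero => simp
  | succ a ih =>
    rw [altProd_succ, mul_assoc, ih, show a + 1 + b = a + b + 1 by ring, inv_altProd_succ,
      letter_succ, letter_succ]

theorem inv_altProd_mul_altProd (i j : B) (k : ℕ) :
    (altProd cs.simple i j k)⁻¹ * altProd cs.simple j i k =
      (cs.simple i * cs.simple j) ^ k := by
  induction k generalizing i j with
  | zero => simp
  | succ k ih =>
    rw [inv_altProd_succ, altProd_succ', mul_assoc, ← mul_assoc _ _ (cs.simple j), ih,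
      mul_pow_mul, pow_succ', mul_assoc]

theorem altProd_eq_iff (i j : B) (k : ℕ) :
    altProd cs.simple i j k = altProd cs.simple j i k ↔ simpleOrder cs i j ∣ k := by
  rw [simpleOrder, orderOf_dvd_iff_pow_eq_one, ← inv_altProd_mul_altProd, inv_mul_eq_one]

/-- Only a = 0 is wanted. Stripping the first letter conjugates the reflection, which raises the
exponent by one and exchanges i and j, so the induction needs every a. A nonzero contribution would
force (s_j s_i)^(a+1) = 1, too early for the order. -/
theorem inversionSign_inv_altProd_aux (i j : B) (a k : ℕ) (h : a + k < simpleOrder cs i j) :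
    inversionSign cs (altProd cs.simple i j k)⁻¹ ((cs.simple j * cs.simple i) ^ a * cs.simple j)
      = 0 := by
  induction k generalizing i j a with
  | zero => simp
  | succ k ih =>
    rw [inv_altProd_succ, inversionSign_mul, inversionSign_simple, if_neg, zero_add]
    · have := ih j i (a + 1) (by rw [simpleOrder_comm]; omega)
      rw [cs.inv_simple]
      convert this using 2
      rw [mul_assoc, mul_assoc, ← pow_succ, mul_pow_mul]
    · intro h1
      have h2 : (cs.simple j * cs.simple i) ^ (a + 1) = 1 := by
        rw [pow_succ, ← mul_assoc, h1, cs.simple_mul_simple_self]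
      have h3 := Nat.le_of_dvd (Nat.succ_pos a) (orderOf_dvd_of_pow_eq_one h2)
      rw [simpleOrder_comm, simpleOrder] at h
      omega

theorem inversionSign_inv_altProd (i j : B) (k : ℕ) (h : k < simpleOrder cs i j) :
    inversionSign cs (altProd cs.simple i j k)⁻¹ (cs.simple j) = 0 := by
  simpa using inversionSign_inv_altProd_aux cs i j 0 k (by omega)

theorem inversionSign_inv_altProd_succ (i j : B) (k : ℕ) (h : k < simpleOrder cs i j) :
    inversionSign cs (altProd cs.simple i j (k + 1))⁻¹ (cs.simple i) = 1 := by
  rw [inv_altProd_succ, inversionSign_mul, inversionSign_simple_self, cs.inv_simple,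
    cs.simple_mul_simple_self, one_mul,
    inversionSign_inv_altProd cs j i k (by rwa [simpleOrder_comm]), add_zero]

theorem inversionSign_altProd_mul_inv (i j : B) (a b : ℕ) (h : a + b < simpleOrder cs i j) :
    inversionSign cs (altProd cs.simple i j a * (altProd cs.simple j i b)⁻¹)
      (cs.simple (letter i j a)) = 0 := by
  rw [altProd_mul_inv_altProd]
  exact inversionSign_inv_altProd cs _ _ _ (by rwa [simpleOrder_letter, simpleOrder_comm])

/-- The rank two parabolic subgroup. -/
def dihedral (i j : B) : Subgroup W := Subgroup.closure {cs.simple i, cs.simple j}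

theorem dihedral_comm (i j : B) : dihedral cs i j = dihedral cs j i := by
  rw [dihedral, Set.pair_comm, dihedral]

theorem simple_mem_dihedral_left (i j : B) : cs.simple i ∈ dihedral cs i j :=
  Subgroup.subset_closure (by simp)

theorem simple_mem_dihedral_right (i j : B) : cs.simple j ∈ dihedral cs i j :=
  Subgroup.subset_closure (by simp)

theorem altProd_mem_dihedral (i j : B) (k : ℕ) : altProd cs.simple i j k ∈ dihedral cs i j := by
  induction k with
  | zero => exact one_mem _
  | succ k ih =>
    refine mul_mem ?_ ih
    rcases letter_cases i j k with ⟨h1, -⟩ | ⟨h1, -⟩ <;> rw [h1]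
    · exact simple_mem_dihedral_left cs i j
    · exact simple_mem_dihedral_right cs i j

theorem dihedral_induction {i j : B} {p : W → Prop} (one : p 1)
    (left : ∀ x ∈ dihedral cs i j, p x → p (cs.simple i * x))
    (right : ∀ x ∈ dihedral cs i j, p x → p (cs.simple j * x)) {x : W}
    (hx : x ∈ dihedral cs i j) : p x := by
  induction hx using Subgroup.closure_induction_left with
  | one => exact one
  | mul_left y hy x hx ih =>
    rcases hy with rfl | rfl
    · exact left _ hx ih
    · exact right _ hx ih
  | inv_mul_cancel y hy x hx ih =>
    rcases hy with rfl | rfl <;> rw [cs.inv_simple]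
    · exact left _ hx ih
    · exact right _ hx ih

theorem exists_altProd_of_mem_dihedral {i j : B} (hm : 0 < simpleOrder cs i j) {x : W}
    (hx : x ∈ dihedral cs i j) :
    ∃ k ≤ simpleOrder cs i j,
      x = (altProd cs.simple i j k)⁻¹ ∨ x = (altProd cs.simple j i k)⁻¹ := by
  have step : ∀ (i j : B) (x : W), 0 < simpleOrder cs i j → (∃ k ≤ simpleOrder cs i j,
      x = (altProd cs.simple i j k)⁻¹ ∨ x = (altProd cs.simple j i k)⁻¹) →
      ∃ k ≤ simpleOrder cs i j, cs.simple i * x = (altProd cs.simple i j k)⁻¹ ∨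
        cs.simple i * x = (altProd cs.simple j i k)⁻¹ := by
    have cancel : ∀ (i j : B) (k : ℕ), cs.simple i * (altProd cs.simple i j (k + 1))⁻¹ =
        (altProd cs.simple j i k)⁻¹ := by
      intro i j k
      rw [inv_altProd_succ, cs.simple_mul_simple_cancel_left]
    rintro i j x hm ⟨k, hk, rfl | rfl⟩
    · rcases k with _ | k
      · exact ⟨1, hm, Or.inl (by rw [inv_altProd_succ]; simp)⟩
      · exact ⟨k, by omega, Or.inr (cancel i j k)⟩
    -- At full length the word cannot be extended; it equals the alternating word starting with the
    -- other letter, and the new letter cancels.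
    · rcases hk.eq_or_lt with rfl | hk
      · rw [← (altProd_eq_iff cs i j _).2 dvd_rfl]
        obtain ⟨k, hk⟩ := Nat.exists_eq_succ_of_ne_zero hm.ne'
        rw [hk]
        exact ⟨k, by omega, Or.inr (cancel i j k)⟩
      · exact ⟨k + 1, hk, Or.inl (inv_altProd_succ cs i j k).symm⟩
  refine dihedral_induction cs (p := fun x => ∃ k ≤ simpleOrder cs i j,
      x = (altProd cs.simple i j k)⁻¹ ∨ x = (altProd cs.simple j i k)⁻¹)
    ⟨0, Nat.zero_le _, by simp⟩ (fun x _ h => step i j x hm h) (fun x _ h => ?_) hx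
  obtain ⟨k, hk, h⟩ := step j i x (by rwa [simpleOrder_comm])
    (by obtain ⟨k, hk, h⟩ := h; exact ⟨k, by rwa [simpleOrder_comm], h.symm⟩)
  exact ⟨k, by rwa [simpleOrder_comm], h.symm⟩

/-- The reflections of the rank two parabolic subgroup. -/
def IsDihedralReflection (i j : B) (τ : W) : Prop :=
  ∃ x ∈ dihedral cs i j, τ = x * cs.simple i * x⁻¹ ∨ τ = x * cs.simple j * x⁻¹

theorem isDihedralReflection_left (i j : B) : IsDihedralReflection cs i j (cs.simple i) :=
  ⟨1, one_mem _, by simp⟩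

theorem isDihedralReflection_right (i j : B) : IsDihedralReflection cs i j (cs.simple j) :=
  ⟨1, one_mem _, by simp⟩

theorem isDihedralReflection_comm {i j : B} {τ : W} (h : IsDihedralReflection cs i j τ) :
    IsDihedralReflection cs j i τ := by
  obtain ⟨x, hx, h⟩ := h
  exact ⟨x, by rwa [dihedral_comm], h.symm⟩

variable {cs}

theorem IsDihedralReflection.isReflection {i j : B} {τ : W}
    (h : IsDihedralReflection cs i j τ) : cs.IsReflection τ := by
  obtain ⟨x, -, h | h⟩ := h
  · exact ⟨x, i, h⟩
  · exact ⟨x, j, h⟩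

theorem IsDihedralReflection.mem {i j : B} {τ : W} (h : IsDihedralReflection cs i j τ) :
    τ ∈ dihedral cs i j := by
  obtain ⟨x, hx, rfl | rfl⟩ := h
  · exact mul_mem (mul_mem hx (simple_mem_dihedral_left cs i j)) (inv_mem hx)
  · exact mul_mem (mul_mem hx (simple_mem_dihedral_right cs i j)) (inv_mem hx)

theorem IsDihedralReflection.conj {i j : B} {τ y : W} (h : IsDihedralReflection cs i j τ)
    (hy : y ∈ dihedral cs i j) : IsDihedralReflection cs i j (y⁻¹ * τ * y) := by
  obtain ⟨x, hx, rfl | rfl⟩ := h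
  · exact ⟨y⁻¹ * x, mul_mem (inv_mem hy) hx, Or.inl (by simp [mul_assoc])⟩
  · exact ⟨y⁻¹ * x, mul_mem (inv_mem hy) hx, Or.inr (by simp [mul_assoc])⟩

variable (cs)

theorem inversionSign_eq_zero_of_not_isDihedralReflection {i j : B} {x : W}
    (hx : x ∈ dihedral cs i j) {τ : W} (hτ : ¬ IsDihedralReflection cs i j τ) :
    inversionSign cs x τ = 0 := by
  have step : ∀ k : B, IsDihedralReflection cs i j (cs.simple k) → ∀ x : W,
      (∀ τ, ¬ IsDihedralReflection cs i j τ → inversionSign cs x τ = 0) →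
      ∀ τ, ¬ IsDihedralReflection cs i j τ → inversionSign cs (cs.simple k * x) τ = 0 := by
    intro k hk x ih τ hτ
    rw [inversionSign_mul, inversionSign_simple, if_neg, zero_add]
    · refine ih _ fun h => hτ ?_
      have := h.conj hk.mem
      simpa [mul_assoc] using this
    · rintro rfl
      exact hτ hk
  exact dihedral_induction cs
    (p := fun x => ∀ τ, ¬ IsDihedralReflection cs i j τ → inversionSign cs x τ = 0) (by simp)
    (fun x _ => step i (isDihedralReflection_left cs i j) x)
    (fun x _ => step j (isDihedralReflection_right cs i j) x) hx τ hτ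

theorem zmod_two_cases (x : ZMod 2) : x = 0 ∨ x = 1 := by revert x; decide

/-- Every element factors through a minimal representative of its right coset. -/
theorem exists_dihedral_factorization (i j : B) (w : W) :
    ∃ x ∈ dihedral cs i j, ∃ u, w = x * u ∧
      ∀ τ, IsDihedralReflection cs i j τ → inversionSign cs u τ = 0 := by
  induction h : cs.length w using Nat.strong_induction_on generalizing w with
  | _ n ih =>
    subst h
    by_cases h0 : ∀ τ, IsDihedralReflection cs i j τ → inversionSign cs w τ = 0
    · exact ⟨1, one_mem _, w, (one_mul w).symm, h0⟩
    · push Not at h0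
      obtain ⟨τ, hτ, h1⟩ := h0
      obtain ⟨x, hx, u, hu, hmin⟩ := ih _ (length_mul_lt_of_inversionSign cs
        ((zmod_two_cases _).resolve_left h1)) (τ * w) rfl
      refine ⟨τ * x, mul_mem hτ.mem hx, u, ?_, hmin⟩
      rw [mul_assoc, ← hu, ← mul_assoc, hτ.isReflection.mul_self, one_mul]

/-- Factor z = xu with u free of inversions in the dihedral subgroup. The inversions of z there are
those of x, and a nontrivial alternating word x has its first letter as a descent; so x = 1. -/
theorem inversionSign_eq_zero_of_minimal {i j : B} (hm : 0 < simpleOrder cs i j) {z : W}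
    (hi : inversionSign cs z (cs.simple i) = 0) (hj : inversionSign cs z (cs.simple j) = 0)
    {τ : W} (hτ : IsDihedralReflection cs i j τ) : inversionSign cs z τ = 0 := by
  obtain ⟨x, hx, u, rfl, hu⟩ := exists_dihedral_factorization cs i j z
  have hxi : ∀ τ, IsDihedralReflection cs i j τ →
      inversionSign cs (x * u) τ = inversionSign cs x τ := by
    intro τ hτ
    rw [inversionSign_mul, hu _ (hτ.conj hx), add_zero]
  obtain ⟨k, hk, h⟩ := exists_altProd_of_mem_dihedral cs hm hx
  rcases k with _ | k
  · have : x = 1 := by simpa using h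
    rw [hxi τ hτ, this, inversionSign_one]
  · exfalso
    rw [hxi _ (isDihedralReflection_left cs i j)] at hi
    rw [hxi _ (isDihedralReflection_right cs i j)] at hj
    rcases h with rfl | rfl
    · rw [inversionSign_inv_altProd_succ cs i j k hk] at hi
      exact one_ne_zero hi
    · rw [inversionSign_inv_altProd_succ cs j i k (by rwa [simpleOrder_comm])] at hj
      exact one_ne_zero hj

section Minimal

variable {i j : B} (hm : 0 < simpleOrder cs i j) {z : W} (hz : z * z = 1)
  (hi : inversionSign cs z (cs.simple i) = 0) (hj : inversionSign cs z (cs.simple j) = 0)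

include hm hz hi hj

/-- The element z s_l can have only one inversion among the dihedral reflections, namely z s_l z. If
that were neither s_i nor s_j, then z s_l would have neither as a descent and hence no dihedral
inversion at all. -/
theorem conj_simple_eq_of_isDihedralReflection {l : B}
    (h : IsDihedralReflection cs i j (z * cs.simple l * z)) :
    z * cs.simple l * z = cs.simple i ∨ z * cs.simple l * z = cs.simple j := by
  have hzi : z⁻¹ = z := inv_eq_of_mul_eq_one_right hz
  have key : ∀ τ, IsDihedralReflection cs i j τ →
      inversionSign cs (z * cs.simple l) τ = inversionSign cs (cs.simple l) (z * τ * z) := by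
    intro τ hτ
    rw [inversionSign_mul, inversionSign_eq_zero_of_minimal cs hm hi hj hτ, zero_add, hzi]
  have hne : ∀ τ, IsDihedralReflection cs i j τ → z * cs.simple l * z ≠ τ →
      inversionSign cs (z * cs.simple l) τ = 0 := by
    intro τ hτ hne
    rw [key τ hτ, inversionSign_simple, if_neg]
    intro h1
    apply hne
    rw [← h1, mul_assoc, mul_assoc, mul_assoc, hz, mul_one, ← mul_assoc, hz, one_mul]
  by_contra! hcon
  have h0 := inversionSign_eq_zero_of_minimal cs hm
    (hne _ (isDihedralReflection_left cs i j) hcon.1)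
    (hne _ (isDihedralReflection_right cs i j) hcon.2) h
  rw [key _ h] at h0
  have h2 : z * (z * cs.simple l * z) * z = cs.simple l := by
    rw [mul_assoc, mul_assoc, mul_assoc, hz, mul_one, ← mul_assoc, hz, one_mul]
  rw [h2, inversionSign_simple_self] at h0
  exact one_ne_zero h0

/-- Compute the sign of τz = z(zτz) at κ in two ways. The left form gives 1; the right form gives
the sign of zτz at zκz, which vanishes unless zκz is a dihedral reflection. -/
theorem isDihedralReflection_conj_of_inversionSign {τ κ : W}
    (hτ : IsDihedralReflection cs i j τ) (hτ' : IsDihedralReflection cs i j (z * τ * z))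
    (hκ : IsDihedralReflection cs i j κ) (h : inversionSign cs τ κ = 1) :
    IsDihedralReflection cs i j (z * κ * z) := by
  have hzi : z⁻¹ = z := inv_eq_of_mul_eq_one_right hz
  by_contra hcon
  have h1 : inversionSign cs (τ * z) κ = 1 := by
    rw [inversionSign_mul, h, inversionSign_eq_zero_of_minimal cs hm hi hj (hκ.conj hτ.mem),
      add_zero]
  have h2 : inversionSign cs (z * (z * τ * z)) κ = 0 := by
    rw [inversionSign_mul, inversionSign_eq_zero_of_minimal cs hm hi hj hκ, hzi,
      inversionSign_eq_zero_of_not_isDihedralReflection cs hτ'.mem hcon, add_zero]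
  rw [← mul_assoc, ← mul_assoc, hz, one_mul, h1] at h2
  exact one_ne_zero h2

theorem conj_simple_cases_aux {τ : W} (hτ : IsDihedralReflection cs i j τ)
    (hτ' : IsDihedralReflection cs i j (z * τ * z)) {k : ℕ} (hk : k ≤ simpleOrder cs i j)
    (h : τ = (altProd cs.simple i j k)⁻¹) :
    (IsDihedralReflection cs i j (z * cs.simple i * z) ∧
      IsDihedralReflection cs i j (z * cs.simple j * z)) ∨ τ = cs.simple i := by
  have hc := fun κ => isDihedralReflection_conj_of_inversionSign cs hm hz hi hj (κ := κ) hτ hτ'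
  rcases k with _ | _ | k
  · have h1 := inversionSign_self cs hτ.isReflection
    simp [h] at h1
  · right
    simp [h, inv_altProd_succ]
  -- A word of length at least two beginning s_i s_j has both s_i and s_i s_j s_i as inversions.
  -- Their conjugates by z are then dihedral reflections, and conjugating the second by the first
  -- gives z s_j z.
  · left
    have hI := isDihedralReflection_left cs i j
    have hJ := isDihedralReflection_right cs i j
    have hk' : k < simpleOrder cs j i := by rw [simpleOrder_comm]; omega
    have h1 : IsDihedralReflection cs i j (z * cs.simple i * z) :=
      hc _ hI (by rw [h, inversionSign_inv_altProd_succ cs i j _ (by omega)])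
    refine ⟨h1, ?_⟩
    have hij : cs.simple i ≠ cs.simple j := by
      intro hij
      have : simpleOrder cs i j = 1 := by
        rw [simpleOrder, hij, cs.simple_mul_simple_self, orderOf_one]
      omega
    have h2 : IsDihedralReflection cs i j (cs.simple i * cs.simple j * cs.simple i) := by
      simpa using hJ.conj hI.mem
    have h3 : inversionSign cs τ (cs.simple i * cs.simple j * cs.simple i) = 1 := by
      rw [h, inv_altProd_succ, inversionSign_mul, inversionSign_simple, if_neg, cs.inv_simple,
        show cs.simple i * (cs.simple i * cs.simple j * cs.simple i) * cs.simple i = cs.simple j by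
          simp [← mul_assoc],
        inversionSign_inv_altProd_succ cs j i _ hk', zero_add]
      intro h4
      apply hij
      have h5 : cs.simple i * cs.simple j = 1 := mul_eq_right.1 h4
      rw [← mul_one (cs.simple i), ← cs.simple_mul_simple_self j, ← mul_assoc, h5, one_mul]
    have h4 := (hc _ h2 h3).conj h1.mem
    have e : (z * cs.simple i * z)⁻¹ * (z * (cs.simple i * cs.simple j * cs.simple i) * z) *
        (z * cs.simple i * z) = z * cs.simple j * z := by
      have hzz : ∀ y, z * (z * y) = y := fun y => by rw [← mul_assoc, hz, one_mul]
      simp [mul_assoc, inv_eq_of_mul_eq_one_right hz, hzz]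
    rwa [e] at h4

/-- If an involution `z`, minimal in its double coset, conjugates a reflection of the rank two
parabolic subgroup into that subgroup, then it permutes the simple reflections, or the reflection
is simple. -/
theorem conj_simple_cases {τ : W} (hτ : IsDihedralReflection cs i j τ)
    (hτ' : IsDihedralReflection cs i j (z * τ * z)) :
    (IsDihedralReflection cs i j (z * cs.simple i * z) ∧
      IsDihedralReflection cs i j (z * cs.simple j * z)) ∨
      τ = cs.simple i ∨ τ = cs.simple j := by
  obtain ⟨k, hk, h | h⟩ := exists_altProd_of_mem_dihedral cs hm hτ.mem
  · exact (conj_simple_cases_aux cs hm hz hi hj hτ hτ' hk h).imp_right Or.inl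
  · rw [simpleOrder_comm] at hm hk
    refine (conj_simple_cases_aux cs hm hz hj hi (isDihedralReflection_comm cs hτ)
      (isDihedralReflection_comm cs hτ') hk h).imp (fun h => ?_) Or.inr
    exact ⟨isDihedralReflection_comm cs h.2, isDihedralReflection_comm cs h.1⟩

end Minimal

end Dihedral

/-! ### Alternating products of two operators with a common quadratic relation. -/

section QuadraticPair

variable {R A B : Type*} [CommRing R] [Ring A] [Algebra R A] {f : B → A} {q : R}

/-- In the expansion of the product on the right, the quadratic relations turn the two squares into
lower terms, and what survives beyond the mixed products is q times the difference at k. -/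
theorem altProd_sub_altProd_succ_succ {i j : B} (hi : f i * f i = (q - 1) • f i + q • 1)
    (hj : f j * f j = (q - 1) • f j + q • 1) (k : ℕ) :
    altProd f i j (k + 2) - altProd f j i (k + 2) =
      (f i + f j - (q - 1) • 1) * (altProd f i j (k + 1) - altProd f j i (k + 1)) -
        q • (altProd f i j k - altProd f j i k) := by
  have key : ∀ a b P Q : A, a * a = (q - 1) • a + q • 1 → b * b = (q - 1) • b + q • 1 →
      b * (a * P) - a * (b * Q) =
        (a + b - (q - 1) • 1) * (a * P - b * Q) - q • (P - Q) := by
    intro a b P Q ha hb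
    have h1 : a * (a * P) = (q - 1) • (a * P) + q • P := by
      rw [← mul_assoc, ha, add_mul, smul_mul_assoc, smul_mul_assoc, one_mul]
    have h2 : b * (b * Q) = (q - 1) • (b * Q) + q • Q := by
      rw [← mul_assoc, hb, add_mul, smul_mul_assoc, smul_mul_assoc, one_mul]
    rw [sub_mul, add_mul, mul_sub, mul_sub, h1, h2, smul_mul_assoc, one_mul, smul_sub, smul_sub]
    abel
  simp only [altProd_succ, letter_succ]
  rcases letter_cases i j k with ⟨h1, h2⟩ | ⟨h1, h2⟩ <;> rw [h1, h2, key _ _ _ _ (by assumption)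
    (by assumption)]
  rw [add_comm (f j)]

theorem sub_mul_add_one_eq_zero {x : A} (hx : x * x = (q - 1) • x + q • 1) :
    (x - algebraMap R A q) * (x + 1) = 0 := by
  rw [Algebra.algebraMap_eq_smul_one, mul_add, sub_mul, hx, mul_one, smul_mul_assoc, one_mul]
  module

theorem simple_mul_altProd {i j : B} (hi : f i * f i = (q - 1) • f i + q • 1)
    (hj : f j * f j = (q - 1) • f j + q • 1) (k : ℕ) :
    f (letter i j k) * altProd f i j (k + 1) =
      (q - 1) • altProd f i j (k + 1) + q • altProd f i j k := by
  rw [altProd_succ, ← mul_assoc]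
  rcases letter_cases i j k with ⟨h, -⟩ | ⟨h, -⟩ <;> rw [h]
  · rw [hi, add_mul, smul_mul_assoc, smul_mul_assoc, one_mul]
  · rw [hj, add_mul, smul_mul_assoc, smul_mul_assoc, one_mul]

end QuadraticPair

section QuadraticPairModule

variable {R V B : Type*} [CommRing R] [AddCommGroup V] [Module R V] {f : B → Module.End R V}
  {q : R}

/-- The equaliser of the two alternating products is stable under the generators. -/
theorem altProd_apply_generator {i j : B} (hi : f i * f i = (q - 1) • f i + q • 1)
    (hj : f j * f j = (q - 1) • f j + q • 1) {k : ℕ} {x : V}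
    (h : altProd f i j k x = altProd f j i k x) :
    altProd f i j k (f i x) = altProd f j i k (f i x) := by
  rcases k with _ | k
  · rfl
  -- On one side `f i` extends the alternation; on the other it doubles the last letter. Once the
  -- two products agree on x, the quadratic relation applied at the left end matches the outcomes.
  have h1 : altProd f j i (k + 1) (f i x) = f (letter i j (k + 1)) (altProd f i j (k + 1) x) := by
    rw [← Module.End.mul_apply, ← altProd_succ', altProd_succ, Module.End.mul_apply]
  have h2 : altProd f i j (k + 1) (f i x) =
      (q - 1) • altProd f i j (k + 1) x + q • altProd f j i k x := by
    rw [altProd_succ', Module.End.mul_apply, ← Module.End.mul_apply (f i), hi]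
    simp
  rw [h1, h2, h, letter_succ, ← Module.End.mul_apply, simple_mul_altProd hj hi]
  simp

/-- The two hypotheses are stable under a ↦ a + 1, b ↦ b - 1, c ↦ cq, by the recurrence. Moving
outwards from the middle, b reaches 0, where D vanishes. -/
theorem reflected_sequence_eq_zero {S : Module.End R V} {D : ℕ → V} (h0 : D 0 = 0)
    (hD : ∀ k, D (k + 2) = S (D (k + 1)) - q • D k) (a b : ℕ) (c : R)
    (h1 : D (a + 1) = c • D b) (h2 : q • D a = c • D (b + 1)) : D (a + b + 1) = 0 := by
  induction b generalizing a c with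
  | zero => rw [add_zero, h1, h0, smul_zero]
  | succ b ih =>
    rw [show a + (b + 1) + 1 = a + 1 + b + 1 by ring]
    refine ih (a + 1) (c * q) ?_ ?_
    · rw [hD, h1, h2, map_smul, hD, mul_smul, smul_sub]
      abel
    · rw [h1, ← mul_smul, mul_comm]

end QuadraticPairModule

noncomputable section

/-! ### Lusztig's operators and the quadratic relation. -/

section Operators

variable {B : Type*} {M : CoxeterMatrix B} {W : Type*} [Group W] (cs : CoxeterSystem M W)

/-- The operator on the free module on involutions given by Lusztig's formula. -/
def lusztigOp (i : B) : Module.End Scalars (InvModule W) :=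
  Finsupp.linearCombination Scalars (lusztigFormula cs i)

theorem lusztigOp_a (i : B) (w : Involutions W) : lusztigOp cs i (a w) = lusztigFormula cs i w := by
  simp [lusztigOp, a]

theorem end_ext_a {f g : Module.End Scalars (InvModule W)} (h : ∀ w, f (a w) = g (a w)) :
    f = g :=
  Finsupp.lhom_ext' fun w => LinearMap.ext_ring (h w)

open Classical in
/-- The basis vector attached to an involution, extended by zero to the whole group. -/
def basisVec (w : W) : InvModule W := if h : w ^ 2 = 1 then a ⟨w, h⟩ else 0

theorem basisVec_coe (w : Involutions W) : basisVec w.1 = a w := dif_pos w.2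

theorem basisVec_eq {w : W} (h : w ^ 2 = 1) : basisVec w = a ⟨w, h⟩ := dif_pos h

/-- Lusztig's formula tests right multiplication and the cocycle tests left multiplication;
inversion exchanges the two for an involution. -/
theorem length_mul_simple_gt_iff {i : B} {w : W} (hw : w * w = 1) :
    cs.length (w * cs.simple i) > cs.length w ↔ inversionSign cs w (cs.simple i) = 0 := by
  rw [inversionSign_eq_zero_iff cs (cs.isReflection_simple i), gt_iff_lt, ← cs.length_inv (_ * _),
    mul_inv_rev, cs.inv_simple, inv_eq_of_mul_eq_one_right hw]

section Rules

variable {cs} {i : B} {w : W}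

theorem mul_self_of_commute (hw : w * w = 1) (hc : cs.simple i * w = w * cs.simple i) :
    cs.simple i * w * (cs.simple i * w) = 1 := by
  nth_rewrite 1 [hc]
  rw [mul_assoc, cs.simple_mul_simple_cancel_left, hw]

theorem mul_self_of_conj (hw : w * w = 1) :
    cs.simple i * w * cs.simple i * (cs.simple i * w * cs.simple i) = 1 := by
  simp only [mul_assoc, cs.simple_mul_simple_cancel_left]
  rw [← mul_assoc w, hw, one_mul, cs.simple_mul_simple_self]

theorem inversionSign_simple_mul_self :
    inversionSign cs (cs.simple i * w) (cs.simple i) = 1 + inversionSign cs w (cs.simple i) := by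
  rw [inversionSign_mul, inversionSign_simple_self, cs.inv_simple, cs.simple_mul_simple_self,
    one_mul]

theorem inversionSign_conj_self (hw : w * w = 1) (hc : cs.simple i * w ≠ w * cs.simple i) :
    inversionSign cs (cs.simple i * w * cs.simple i) (cs.simple i) =
      1 + inversionSign cs w (cs.simple i) := by
  rw [mul_assoc, inversionSign_simple_mul_self, inversionSign_mul, inversionSign_simple, if_neg,
    add_zero]
  rw [inv_eq_of_mul_eq_one_right hw]
  intro h
  apply hc
  calc cs.simple i * w = w * w * (cs.simple i * w) := by rw [hw, one_mul]
    _ = w * cs.simple i := by rw [mul_assoc w w, ← mul_assoc w _ w, h]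

theorem lusztigOp_of_ascent_commute (hw : w * w = 1)
    (h : inversionSign cs w (cs.simple i) = 0) (hc : cs.simple i * w = w * cs.simple i) :
    lusztigOp cs i (basisVec w) = v • basisVec w + (v + 1) • basisVec (cs.simple i * w) := by
  rw [basisVec_eq (by rwa [pow_two]), lusztigOp_a, lusztigFormula, dif_pos hc,
    if_pos ((length_mul_simple_gt_iff cs hw).2 h), ← basisVec_coe (mulInv _ _ _ _)]
  rfl

/-- The descent rules are parametrised by the shorter involution of the pair, so they share their
hypotheses with the ascent rules. -/
theorem lusztigOp_of_descent_commute (hw : w * w = 1)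
    (h : inversionSign cs w (cs.simple i) = 0) (hc : cs.simple i * w = w * cs.simple i) :
    lusztigOp cs i (basisVec (cs.simple i * w)) =
      (v ^ 2 - v - 1) • basisVec (cs.simple i * w) + (v ^ 2 - v) • basisVec w := by
  have hw' := mul_self_of_commute hw hc
  have hc' : cs.simple i * (cs.simple i * w) = cs.simple i * w * cs.simple i := by
    rw [mul_assoc, ← hc]
  rw [basisVec_eq (by rwa [pow_two]), lusztigOp_a, lusztigFormula, dif_pos hc', if_neg,
    ← basisVec_coe (mulInv _ _ _ _)]
  · simp [mulInv]
  · rw [length_mul_simple_gt_iff cs hw', inversionSign_simple_mul_self, h]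
    decide

theorem lusztigOp_of_ascent (hw : w * w = 1)
    (h : inversionSign cs w (cs.simple i) = 0) (hc : cs.simple i * w ≠ w * cs.simple i) :
    lusztigOp cs i (basisVec w) = basisVec (cs.simple i * w * cs.simple i) := by
  rw [basisVec_eq (by rwa [pow_two]), lusztigOp_a, lusztigFormula, dif_neg hc,
    if_pos ((length_mul_simple_gt_iff cs hw).2 h), ← basisVec_coe (conjInv _ _ _)]
  rfl

theorem lusztigOp_of_descent (hw : w * w = 1)
    (h : inversionSign cs w (cs.simple i) = 0) (hc : cs.simple i * w ≠ w * cs.simple i) :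
    lusztigOp cs i (basisVec (cs.simple i * w * cs.simple i)) =
      (v ^ 2 - 1) • basisVec (cs.simple i * w * cs.simple i) + v ^ 2 • basisVec w := by
  have hw' := mul_self_of_conj (cs := cs) (i := i) hw
  have hc' : cs.simple i * (cs.simple i * w * cs.simple i) ≠
      cs.simple i * w * cs.simple i * cs.simple i := by
    rw [cs.simple_mul_simple_cancel_right, mul_assoc, cs.simple_mul_simple_cancel_left]
    exact hc.symm
  rw [basisVec_eq (by rwa [pow_two]), lusztigOp_a, lusztigFormula, dif_neg hc', if_neg,
    ← basisVec_coe (conjInv _ _ _)]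
  · simp [conjInv, mul_assoc]
  · rw [length_mul_simple_gt_iff cs hw', inversionSign_conj_self hw hc, h]
    decide

/-- A descent of an involution comes from a shorter involution. -/
theorem exists_ascent_of_descent (hw : w * w = 1) (h : inversionSign cs w (cs.simple i) = 1) :
    ∃ u, u * u = 1 ∧ inversionSign cs u (cs.simple i) = 0 ∧ cs.length u < cs.length w ∧
      ((cs.simple i * u = u * cs.simple i ∧ w = cs.simple i * u) ∨
        (cs.simple i * u ≠ u * cs.simple i ∧ w = cs.simple i * u * cs.simple i)) := by
  have hlt := length_mul_lt_of_inversionSign cs h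
  have hr := cs.isReflection_simple i
  by_cases hc : cs.simple i * w = w * cs.simple i
  · refine ⟨cs.simple i * w, mul_self_of_commute hw hc, ?_, hlt, Or.inl ⟨?_, by simp⟩⟩
    · rw [inversionSign_simple_mul_self, h]; decide
    · rw [mul_assoc, ← hc]
  · have h0 : inversionSign cs (cs.simple i * w * cs.simple i) (cs.simple i) = 0 := by
      rw [inversionSign_conj_self hw hc, h]; decide
    refine ⟨_, mul_self_of_conj hw, h0, ?_, Or.inr ⟨?_, by simp [mul_assoc]⟩⟩
    · have h1 := (inversionSign_eq_zero_iff cs hr).1 h0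
      rw [mul_assoc, cs.simple_mul_simple_cancel_left] at h1
      have h2 : cs.length (w * cs.simple i) = cs.length (cs.simple i * w) := by
        rw [← cs.length_inv, mul_inv_rev, cs.inv_simple, inv_eq_of_mul_eq_one_right hw]
      rw [mul_assoc]
      omega
    · rw [cs.simple_mul_simple_cancel_right, mul_assoc, cs.simple_mul_simple_cancel_left]
      exact fun h => hc h.symm

end Rules

theorem lusztigOp_mul_self (i : B) :
    lusztigOp cs i * lusztigOp cs i = (v ^ 2 - 1) • lusztigOp cs i + v ^ 2 • 1 := by
  refine end_ext_a fun w => ?_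
  have hw : w.1 * w.1 = 1 := by rw [← pow_two, w.2]
  rw [← basisVec_coe, Module.End.mul_apply, LinearMap.add_apply, LinearMap.smul_apply,
    LinearMap.smul_apply, Module.End.one_apply]
  have comm : ∀ u : W, u * u = 1 → inversionSign cs u (cs.simple i) = 0 →
      cs.simple i * u = u * cs.simple i →
      lusztigOp cs i (lusztigOp cs i (basisVec u)) =
        (v ^ 2 - 1) • lusztigOp cs i (basisVec u) + v ^ 2 • basisVec u ∧
      lusztigOp cs i (lusztigOp cs i (basisVec (cs.simple i * u))) =
        (v ^ 2 - 1) • lusztigOp cs i (basisVec (cs.simple i * u)) +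
          v ^ 2 • basisVec (cs.simple i * u) := by
    intro u hu h hc
    constructor <;>
    simp only [lusztigOp_of_ascent_commute hu h hc, lusztigOp_of_descent_commute hu h hc, map_add,
      map_smul] <;> module
  have noncomm : ∀ u : W, u * u = 1 → inversionSign cs u (cs.simple i) = 0 →
      cs.simple i * u ≠ u * cs.simple i →
      lusztigOp cs i (lusztigOp cs i (basisVec u)) =
        (v ^ 2 - 1) • lusztigOp cs i (basisVec u) + v ^ 2 • basisVec u ∧
      lusztigOp cs i (lusztigOp cs i (basisVec (cs.simple i * u * cs.simple i))) =
        (v ^ 2 - 1) • lusztigOp cs i (basisVec (cs.simple i * u * cs.simple i)) +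
          v ^ 2 • basisVec (cs.simple i * u * cs.simple i) := by
    intro u hu h hc
    constructor <;>
    simp only [lusztigOp_of_ascent hu h hc, lusztigOp_of_descent hu h hc, map_add, map_smul]
  rcases zmod_two_cases (inversionSign cs w.1 (cs.simple i)) with h | h
  · by_cases hc : cs.simple i * w.1 = w.1 * cs.simple i
    · exact (comm _ hw h hc).1
    · exact (noncomm _ hw h hc).1
  · obtain ⟨u, hu, h0, -, ⟨hc, he⟩ | ⟨hc, he⟩⟩ := exists_ascent_of_descent hw h
    · rw [he]; exact (comm u hu h0 hc).2
    · rw [he]; exact (noncomm u hu h0 hc).2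

end Operators

/-! ### Orbits of a minimal involution with at most one reflection conjugated into the dihedral
subgroup. -/

section Cosets

variable {B : Type*} {M : CoxeterMatrix B} {W : Type*} [Group W] (cs : CoxeterSystem M W)

theorem altProd_succ_mul_inv_eq_iff (i j : B) (a b : ℕ) :
    altProd cs.simple i j (a + 1) * (altProd cs.simple j i b)⁻¹ =
        altProd cs.simple i j a * (altProd cs.simple j i (b + 1))⁻¹ ↔
      simpleOrder cs i j ∣ a + b + 1 := by
  rw [altProd_mul_inv_altProd, altProd_mul_inv_altProd, inv_inj, letter_succ, letter_succ,
    show a + 1 + b = a + b + 1 by ring, show a + (b + 1) = a + b + 1 by ring, altProd_eq_iff,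
    simpleOrder_letter]

theorem altProd_mul_inv_eq_iff (i j : B) (a b : ℕ) :
    altProd cs.simple i j a * (altProd cs.simple j i b)⁻¹ =
        altProd cs.simple j i a * (altProd cs.simple i j b)⁻¹ ↔
      simpleOrder cs i j ∣ a + b := by
  rw [altProd_mul_inv_altProd, altProd_mul_inv_altProd, inv_inj, altProd_eq_iff,
    simpleOrder_letter, simpleOrder_comm]

variable {cs} {i j : B} {z : W}

theorem isDihedralReflection_letter (cs : CoxeterSystem M W) (i j : B) (k : ℕ) :
    IsDihedralReflection cs i j (cs.simple (letter i j k)) := by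
  rcases letter_cases i j k with ⟨h, -⟩ | ⟨h, -⟩ <;> rw [h]
  · exact isDihedralReflection_left cs i j
  · exact isDihedralReflection_right cs i j

theorem conj_eq_of_commute (hz : z * z = 1) {x y r : W} (h : r * (x * z * y) = x * z * y * r) :
    z * (x⁻¹ * r * x) * z = y * r * y⁻¹ := by
  calc z * (x⁻¹ * r * x) * z = z * x⁻¹ * (r * (x * z * y)) * y⁻¹ := by group
    _ = (z * z) * y * r * y⁻¹ := by rw [h]; group
    _ = y * r * y⁻¹ := by rw [hz, one_mul]

theorem commute_of_conj_eq (hz : z * z = 1) {x y r : W}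
    (h : z * (x⁻¹ * r * x) * z = y * r * y⁻¹) : r * (x * z * y) = x * z * y * r := by
  calc r * (x * z * y) = x * (z * z) * (x⁻¹ * r * x) * z * y := by rw [hz]; group
    _ = x * z * (z * (x⁻¹ * r * x) * z) * y := by group
    _ = x * z * y * r := by rw [h]; group

theorem mul_self_conj (hz : z * z = 1) (x : W) : x * z * x⁻¹ * (x * z * x⁻¹) = 1 := by
  calc x * z * x⁻¹ * (x * z * x⁻¹) = x * (z * z) * x⁻¹ := by group
    _ = 1 := by rw [hz]; group

/-- In the cocycle expansion over x, z, y the middle term vanishes by minimality of z, and the last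
one can be nonzero only if z carries the reflection x⁻¹rx into the dihedral subgroup. -/
theorem inversionSign_double_coset (hm : 0 < simpleOrder cs i j) (hz : z * z = 1)
    (hi : inversionSign cs z (cs.simple i) = 0) (hj : inversionSign cs z (cs.simple j) = 0)
    {x y r : W} (hx : x ∈ dihedral cs i j) (hy : y ∈ dihedral cs i j)
    (hr : IsDihedralReflection cs i j r) (hxr : inversionSign cs x r = 0)
    (h : IsDihedralReflection cs i j (z * (x⁻¹ * r * x) * z) →
      inversionSign cs y (z * (x⁻¹ * r * x) * z) = 0) :
    inversionSign cs (x * z * y) r = 0 := by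
  rw [mul_assoc, inversionSign_mul, hxr, inversionSign_mul,
    inversionSign_eq_zero_of_minimal cs hm hi hj (hr.conj hx), zero_add, zero_add,
    inv_eq_of_mul_eq_one_right hz]
  by_cases hτ : IsDihedralReflection cs i j (z * (x⁻¹ * r * x) * z)
  · exact h hτ
  · exact inversionSign_eq_zero_of_not_isDihedralReflection cs hy hτ

theorem inversionSign_altProd (cs : CoxeterSystem M W) (i j : B) {k : ℕ}
    (h : k < simpleOrder cs i j) :
    inversionSign cs (altProd cs.simple i j k) (cs.simple (letter i j k)) = 0 := by
  simpa using inversionSign_altProd_mul_inv cs i j k 0 h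

variable (hm : 0 < simpleOrder cs i j) (hz : z * z = 1)
  (hi : inversionSign cs z (cs.simple i) = 0) (hj : inversionSign cs z (cs.simple j) = 0)

include hm hz hi hj

/-- If no reflection of the rank two parabolic subgroup is conjugated into it by `z`, the generators
act along the orbit of `z` by conjugation. -/
theorem lusztigOp_altProd_of_free
    (hfree : ∀ τ, IsDihedralReflection cs i j τ → ¬ IsDihedralReflection cs i j (z * τ * z))
    {k : ℕ} (hk : k ≤ simpleOrder cs i j) :
    altProd (lusztigOp cs) i j k (basisVec z) =
      basisVec (altProd cs.simple i j k * z * (altProd cs.simple i j k)⁻¹) := by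
  induction k with
  | zero => simp
  | succ k ih =>
    have hp := altProd_mem_dihedral cs i j k
    have hr := isDihedralReflection_letter cs i j k
    rw [altProd_succ, Module.End.mul_apply, ih (by omega), lusztigOp_of_ascent]
    · rw [inv_altProd_succ', altProd_succ]
      simp only [mul_assoc]
    · exact mul_self_conj hz _
    · exact inversionSign_double_coset hm hz hi hj hp (inv_mem hp) hr
        (inversionSign_altProd cs i j hk) fun h => absurd h (hfree _ (hr.conj hp))
    · intro h
      refine hfree _ (hr.conj hp) ?_
      rw [conj_eq_of_commute hz h]
      simpa using hr.conj hp

section OneFixed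

variable (hzi : z * cs.simple i * z = cs.simple i)
  (hfix : ∀ τ, IsDihedralReflection cs i j τ → IsDihedralReflection cs i j (z * τ * z) →
    τ = cs.simple i)

include hzi hfix

theorem ascent_of_one_fixed_conj {k : ℕ} (hk : k < simpleOrder cs i j) :
    inversionSign cs (altProd cs.simple j i k * z * (altProd cs.simple j i k)⁻¹)
      (cs.simple (letter j i k)) = 0 := by
  have hp := altProd_mem_dihedral cs j i k
  rw [dihedral_comm] at hp
  have hr := isDihedralReflection_comm cs (isDihedralReflection_letter cs j i k)
  refine inversionSign_double_coset hm hz hi hj hp (inv_mem hp) hr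
    (inversionSign_altProd cs j i (by rwa [simpleOrder_comm])) fun h => ?_
  rw [hfix _ (hr.conj hp) h, hzi]
  exact inversionSign_inv_altProd cs j i k (by rwa [simpleOrder_comm])

theorem ascent_of_one_fixed {k : ℕ} (hk : k + 1 < simpleOrder cs i j) :
    inversionSign cs (altProd cs.simple i j (k + 1) * z * (altProd cs.simple j i k)⁻¹)
      (cs.simple (letter j i k)) = 0 := by
  have hp := altProd_mem_dihedral cs i j (k + 1)
  have hq := altProd_mem_dihedral cs j i k
  rw [dihedral_comm] at hq
  have hr := isDihedralReflection_comm cs (isDihedralReflection_letter cs j i k)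
  refine inversionSign_double_coset hm hz hi hj hp (inv_mem hq) hr
    (by simpa using inversionSign_altProd cs i j hk) fun h => ?_
  rw [hfix _ (hr.conj hp) h, hzi]
  exact inversionSign_inv_altProd cs j i k (by rw [simpleOrder_comm]; omega)

omit hm hz hi hj hzi hfix in
-- This locates the step at which the conjugation chain of z stops being free: the next letter
-- corresponds to the fixed reflection s_i exactly when the two alternating words of length k + 1
-- coincide.
theorem conj_letter_eq_iff (k : ℕ) :
    (altProd cs.simple j i k)⁻¹ * cs.simple (letter j i k) * altProd cs.simple j i k =
      cs.simple i ↔ simpleOrder cs i j ∣ k + 1 := by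
  rw [← altProd_eq_iff, altProd_succ' _ i j, altProd_succ _ j i, mul_assoc, inv_mul_eq_iff_eq_mul,
    eq_comm]

omit hm hi hj hzi in
theorem not_commute_of_one_fixed_conj {k : ℕ} (hk : k + 1 < simpleOrder cs i j) :
    cs.simple (letter j i k) * (altProd cs.simple j i k * z * (altProd cs.simple j i k)⁻¹) ≠
      altProd cs.simple j i k * z * (altProd cs.simple j i k)⁻¹ * cs.simple (letter j i k) := by
  intro h
  have hp := altProd_mem_dihedral cs j i k
  rw [dihedral_comm] at hp
  have hr := isDihedralReflection_comm cs (isDihedralReflection_letter cs j i k)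
  have h1 := conj_eq_of_commute hz h
  rw [inv_inv] at h1
  have h2 := hfix _ (hr.conj hp) (by rw [h1]; exact hr.conj hp)
  rw [conj_letter_eq_iff] at h2
  exact absurd (Nat.le_of_dvd (Nat.succ_pos k) h2) (by omega)

omit hm hi hj in
theorem not_commute_of_one_fixed {k : ℕ} (hk : k + 1 < simpleOrder cs i j) :
    cs.simple (letter j i k) *
        (altProd cs.simple i j (k + 1) * z * (altProd cs.simple j i k)⁻¹) ≠
      altProd cs.simple i j (k + 1) * z * (altProd cs.simple j i k)⁻¹ *
        cs.simple (letter j i k) := by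
  intro h
  have hp := altProd_mem_dihedral cs i j (k + 1)
  have hq := altProd_mem_dihedral cs j i k
  rw [dihedral_comm] at hq
  have hr := isDihedralReflection_comm cs (isDihedralReflection_letter cs j i k)
  have h1 := conj_eq_of_commute hz h
  rw [inv_inv] at h1
  have h2 := hfix _ (hr.conj hp) (by rw [h1]; exact hr.conj hq)
  rw [h2, hzi, eq_comm, conj_letter_eq_iff] at h1
  exact absurd (Nat.le_of_dvd (Nat.succ_pos k) h1) (by omega)

omit hm hz hi hj hfix in
theorem mul_self_of_one_fixed (k : ℕ) :
    altProd cs.simple i j (k + 1) * z * (altProd cs.simple j i k)⁻¹ *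
      (altProd cs.simple i j (k + 1) * z * (altProd cs.simple j i k)⁻¹) = 1 := by
  rw [altProd_succ']
  generalize altProd cs.simple j i k = q
  have h : cs.simple i * z * (cs.simple i * z) = 1 := by
    rw [mul_assoc, ← mul_assoc z, hzi, cs.simple_mul_simple_self]
  calc q * cs.simple i * z * q⁻¹ * (q * cs.simple i * z * q⁻¹) =
      q * (cs.simple i * z * (cs.simple i * z)) * q⁻¹ := by group
    _ = 1 := by rw [h]; group

theorem lusztigOp_altProd_conj_of_one_fixed {k : ℕ} (hk : k < simpleOrder cs i j) :
    altProd (lusztigOp cs) j i k (basisVec z) =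
      basisVec (altProd cs.simple j i k * z * (altProd cs.simple j i k)⁻¹) := by
  induction k with
  | zero => simp
  | succ k ih =>
    rw [altProd_succ, Module.End.mul_apply, ih (by omega), lusztigOp_of_ascent
      (mul_self_conj hz _) (ascent_of_one_fixed_conj hm hz hi hj hzi hfix (by omega))
      (not_commute_of_one_fixed_conj hz hfix hk), inv_altProd_succ', altProd_succ]
    simp only [mul_assoc]

/-- The first operator splits a_z into a_z and a_{s_i z}; the remaining letters then conjugate both
terms in parallel. -/
theorem lusztigOp_altProd_of_one_fixed {k : ℕ} (hk : k < simpleOrder cs i j) :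
    altProd (lusztigOp cs) i j (k + 1) (basisVec z) =
      v • basisVec (altProd cs.simple j i k * z * (altProd cs.simple j i k)⁻¹) +
        (v + 1) • basisVec (altProd cs.simple i j (k + 1) * z * (altProd cs.simple j i k)⁻¹) := by
  induction k with
  | zero =>
    have hc : cs.simple i * z = z * cs.simple i := by
      nth_rewrite 1 [← hzi]
      rw [mul_assoc, hz, mul_one]
    simp [altProd_succ, lusztigOp_of_ascent_commute hz hi hc]
  | succ k ih =>
    rw [altProd_succ, Module.End.mul_apply, ih (by omega), letter_succ, map_add, map_smul, map_smul,
      lusztigOp_of_ascent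
      (mul_self_conj hz _) (ascent_of_one_fixed_conj hm hz hi hj hzi hfix (by omega))
      (not_commute_of_one_fixed_conj hz hfix hk), lusztigOp_of_ascent
      (mul_self_of_one_fixed hzi _) (ascent_of_one_fixed hm hz hi hj hzi hfix hk)
      (not_commute_of_one_fixed hz hzi hfix hk), inv_altProd_succ',
      altProd_succ _ j i, altProd_succ _ i j (k + 1), letter_succ]
    simp only [mul_assoc]

/-- One product meets the commuting step first, the other last. After m - 1 conjugations the final
letter commutes with the involution reached, producing the same coefficients v and v + 1, and the
two words of length m are equal. -/
theorem lusztigOp_braid_of_one_fixed :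
    altProd (lusztigOp cs) i j (simpleOrder cs i j) (basisVec z) =
      altProd (lusztigOp cs) j i (simpleOrder cs i j) (basisVec z) := by
  obtain ⟨k, hk⟩ := Nat.exists_eq_succ_of_ne_zero hm.ne'
  have hlt : k < simpleOrder cs i j := by omega
  have hconj : (altProd cs.simple j i k)⁻¹ * cs.simple (letter j i k) * altProd cs.simple j i k =
      cs.simple i := (conj_letter_eq_iff k).2 (by rw [hk])
  rw [hk, Nat.succ_eq_add_one, lusztigOp_altProd_of_one_fixed hm hz hi hj hzi hfix hlt,
    altProd_succ _ j i, Module.End.mul_apply,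
    lusztigOp_altProd_conj_of_one_fixed hm hz hi hj hzi hfix hlt,
    lusztigOp_of_ascent_commute (mul_self_conj hz _)
      (ascent_of_one_fixed_conj hm hz hi hj hzi hfix hlt)
      (commute_of_conj_eq hz (by rw [inv_inv, hconj, hzi])),
    (altProd_eq_iff cs i j (k + 1)).2 (by rw [hk]), altProd_succ _ j i]
  simp only [mul_assoc]

end OneFixed

end Cosets

/-! ### Minimal involutions that normalize the dihedral subgroup. -/

section Normalizing

variable {B : Type*} {M : CoxeterMatrix B} {W : Type*} [Group W] {cs : CoxeterSystem M W}
  {i j : B} {z : W}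

/-- The difference of the two alternating products of Lusztig operators. -/
def braidDefect (cs : CoxeterSystem M W) (i j : B) (x : InvModule W) (k : ℕ) : InvModule W :=
  altProd (lusztigOp cs) i j k x - altProd (lusztigOp cs) j i k x

/-- The operator governing the recurrence for `braidDefect`. -/
def shiftOp (cs : CoxeterSystem M W) (i j : B) : Module.End Scalars (InvModule W) :=
  lusztigOp cs i + lusztigOp cs j - (v ^ 2 - 1) • 1

theorem shiftOp_apply_letter (cs : CoxeterSystem M W) (i j : B) (k : ℕ) (x : InvModule W) :
    shiftOp cs i j x = lusztigOp cs (letter i j k) x + lusztigOp cs (letter j i k) x -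
      (v ^ 2 - 1) • x := by
  rcases letter_cases i j k with ⟨h1, h2⟩ | ⟨h1, h2⟩ <;> rw [h1, h2] <;> simp [shiftOp]
  rw [add_comm]

theorem shiftOp_comm (cs : CoxeterSystem M W) (i j : B) : shiftOp cs i j = shiftOp cs j i := by
  rw [shiftOp, shiftOp, add_comm (lusztigOp cs i)]

@[simp] theorem braidDefect_zero (cs : CoxeterSystem M W) (i j : B) (x : InvModule W) :
    braidDefect cs i j x 0 = 0 := by simp [braidDefect]

theorem braidDefect_one (cs : CoxeterSystem M W) (i j : B) (x : InvModule W) :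
    braidDefect cs i j x 1 = lusztigOp cs i x - lusztigOp cs j x := by
  simp [braidDefect, altProd_succ]

theorem braidDefect_succ_succ (cs : CoxeterSystem M W) (i j : B) (x : InvModule W) (k : ℕ) :
    braidDefect cs i j x (k + 2) =
      shiftOp cs i j (braidDefect cs i j x (k + 1)) - v ^ 2 • braidDefect cs i j x k := by
  have h := LinearMap.congr_fun (altProd_sub_altProd_succ_succ (f := lusztigOp cs) (lusztigOp_mul_self cs i)
    (lusztigOp_mul_self cs j) k) x
  simpa [braidDefect, shiftOp] using h

theorem eq_mul_of_conj {x y : W} (hz : z * z = 1) (h : z * x * z = y) : z * x = y * z := by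
  rw [← h, mul_assoc, hz, mul_one]

section Swapped

variable (hm : 0 < simpleOrder cs i j) (hz : z * z = 1)
  (hi : inversionSign cs z (cs.simple i) = 0) (hj : inversionSign cs z (cs.simple j) = 0)
  (hzi : z * cs.simple i = cs.simple j * z) (hzj : z * cs.simple j = cs.simple i * z)

/-- The involution reached from `z` by `k` conjugations. -/
def swapPoint (cs : CoxeterSystem M W) (i j : B) (z : W) (k : ℕ) : W :=
  altProd cs.simple i j k * (altProd cs.simple j i k)⁻¹ * z

include hzi hzj in
theorem mul_letter_of_swapped (k : ℕ) :
    z * cs.simple (letter i j k) = cs.simple (letter j i k) * z := by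
  rcases letter_cases i j k with ⟨h1, h2⟩ | ⟨h1, h2⟩ <;> rw [h1, h2] <;> assumption

include hzi hzj in
theorem mul_altProd_of_swapped (k : ℕ) :
    z * altProd cs.simple i j k = altProd cs.simple j i k * z := by
  induction k with
  | zero => simp
  | succ k ih =>
    rw [altProd_succ, altProd_succ _ j i, ← mul_assoc, mul_letter_of_swapped hzi hzj, mul_assoc, ih,
      mul_assoc]

include hzi hzj in
theorem swapPoint_eq (k : ℕ) :
    swapPoint cs i j z k = altProd cs.simple i j k * z * (altProd cs.simple i j k)⁻¹ := by
  rw [swapPoint, mul_assoc, mul_assoc, inv_mul_eq_of_eq_mul, mul_right_inj]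
  rw [← mul_assoc, ← mul_altProd_of_swapped hzi hzj, mul_inv_cancel_right]

include hz hzi hzj in
theorem swapPoint_mul_self (k : ℕ) : swapPoint cs i j z k * swapPoint cs i j z k = 1 := by
  rw [swapPoint_eq hzi hzj]
  exact mul_self_conj hz _

theorem swapPoint_comm_iff (cs : CoxeterSystem M W) (i j : B) (z : W) (k : ℕ) :
    swapPoint cs i j z k = swapPoint cs j i z k ↔ simpleOrder cs i j ∣ 2 * k := by
  rw [swapPoint, swapPoint, mul_left_inj, altProd_mul_inv_eq_iff, two_mul]

include hm hi hj in
theorem swapPoint_ascent {k : ℕ} (hk : 2 * k < simpleOrder cs i j) :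
    inversionSign cs (swapPoint cs i j z k) (cs.simple (letter i j k)) = 0 := by
  have hp := altProd_mem_dihedral cs i j k
  have hq := altProd_mem_dihedral cs j i k
  rw [dihedral_comm] at hq
  rw [swapPoint, inversionSign_mul, inversionSign_altProd_mul_inv cs i j k k (by omega), zero_add]
  exact inversionSign_eq_zero_of_minimal cs hm hi hj
    ((isDihedralReflection_letter cs i j k).conj (mul_mem hp (inv_mem hq)))

include hzi hzj in
theorem swapPoint_mul_letter (k : ℕ) :
    swapPoint cs i j z k * cs.simple (letter i j k) =
      altProd cs.simple i j k * (altProd cs.simple j i (k + 1))⁻¹ * z := by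
  rw [swapPoint, mul_assoc, mul_letter_of_swapped hzi hzj, inv_altProd_succ']
  simp only [mul_assoc]

theorem letter_mul_swapPoint (k : ℕ) :
    cs.simple (letter i j k) * swapPoint cs i j z k =
      altProd cs.simple i j (k + 1) * (altProd cs.simple j i k)⁻¹ * z := by
  rw [swapPoint, altProd_succ]
  simp only [mul_assoc]

include hzi hzj in
theorem swapPoint_commute_iff (k : ℕ) :
    cs.simple (letter i j k) * swapPoint cs i j z k =
      swapPoint cs i j z k * cs.simple (letter i j k) ↔ simpleOrder cs i j ∣ 2 * k + 1 := by
  rw [letter_mul_swapPoint, swapPoint_mul_letter hzi hzj, mul_left_inj,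
    altProd_succ_mul_inv_eq_iff, two_mul]

include hzi hzj in
theorem swapPoint_conj (k : ℕ) :
    cs.simple (letter i j k) * swapPoint cs i j z k * cs.simple (letter i j k) =
      swapPoint cs i j z (k + 1) := by
  rw [mul_assoc, swapPoint_mul_letter hzi hzj, swapPoint, altProd_succ _ i j]
  simp only [mul_assoc]

include hm hz hi hj hzi hzj

theorem lusztigOp_swapPoint {k : ℕ} (hk : 2 * k + 1 < simpleOrder cs i j) :
    lusztigOp cs (letter i j k) (basisVec (swapPoint cs i j z k)) =
      basisVec (swapPoint cs i j z (k + 1)) ∧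
    lusztigOp cs (letter i j k) (basisVec (swapPoint cs i j z (k + 1))) =
      (v ^ 2 - 1) • basisVec (swapPoint cs i j z (k + 1)) +
        v ^ 2 • basisVec (swapPoint cs i j z k) := by
  have h1 := swapPoint_mul_self (cs := cs) hz hzi hzj k
  have h2 := swapPoint_ascent hm hi hj (k := k) (by omega)
  have h3 : cs.simple (letter i j k) * swapPoint cs i j z k ≠
      swapPoint cs i j z k * cs.simple (letter i j k) := by
    intro h
    rw [swapPoint_commute_iff hzi hzj] at h
    exact absurd (Nat.le_of_dvd (Nat.succ_pos _) h) (by omega)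
  rw [← swapPoint_conj hzi hzj k]
  exact ⟨lusztigOp_of_ascent h1 h2 h3, lusztigOp_of_descent h1 h2 h3⟩

theorem shiftOp_swapPoint {k : ℕ} (hk : 2 * k + 3 < simpleOrder cs i j) :
    shiftOp cs i j (basisVec (swapPoint cs i j z (k + 1))) =
      basisVec (swapPoint cs i j z (k + 2)) + v ^ 2 • basisVec (swapPoint cs i j z k) := by
  have h1 := (lusztigOp_swapPoint hm hz hi hj hzi hzj (k := k) (by omega)).2
  have h2 := (lusztigOp_swapPoint hm hz hi hj hzi hzj (k := k + 1) (by omega)).1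
  rw [shiftOp_apply_letter cs i j (k + 1), h2, letter_succ, h1]
  abel

/-- For odd order the middle involution commutes with the next letter, so the move is the commuting
ascent. The new term is z times the alternating word of length m, which is symmetric in i and j and
drops out of differences. -/
theorem shiftOp_swapPoint_last {k : ℕ} (hk : simpleOrder cs i j = 2 * k + 3) :
    shiftOp cs i j (basisVec (swapPoint cs i j z (k + 1))) =
      v • basisVec (swapPoint cs i j z (k + 1)) +
        (v + 1) • basisVec
          (altProd cs.simple i j (k + 2) * (altProd cs.simple j i (k + 1))⁻¹ * z) +
        v ^ 2 • basisVec (swapPoint cs i j z k) := by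
  have h1 := (lusztigOp_swapPoint hm hz hi hj hzi hzj (k := k) (by omega)).2
  have h2 := lusztigOp_of_ascent_commute (swapPoint_mul_self (cs := cs) hz hzi hzj (k + 1))
    (swapPoint_ascent hm hi hj (k := k + 1) (by omega))
    ((swapPoint_commute_iff hzi hzj (k + 1)).2 (by rw [hk]; exact dvd_of_eq (by ring)))
  rw [shiftOp_apply_letter cs i j (k + 1), h2, letter_mul_swapPoint, letter_succ, h1]
  abel

theorem braidDefect_of_swapped :
    ∀ k, 2 * k ≤ simpleOrder cs i j → braidDefect cs i j (basisVec z) k =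
      basisVec (swapPoint cs i j z k) - basisVec (swapPoint cs j i z k) := by
  have hm' : 0 < simpleOrder cs j i := by rwa [simpleOrder_comm]
  intro k
  induction k using Nat.strong_induction_on with
  | _ k ih =>
    intro hk
    rcases k with _ | _ | k
    · simp [swapPoint]
    · have h1 := (lusztigOp_swapPoint hm hz hi hj hzi hzj (k := 0) (by omega)).1
      have h2 := (lusztigOp_swapPoint hm' hz hj hi hzj hzi (k := 0)
        (by rw [simpleOrder_comm]; omega)).1
      have h0 : ∀ i j, swapPoint cs i j z 0 = z := fun i j => by simp [swapPoint]
      rw [h0, letter_zero] at h1 h2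
      rw [braidDefect_one, h1, h2]
    · rw [braidDefect_succ_succ, ih (k + 1) (by omega) (by omega), ih k (by omega) (by omega),
        map_sub, shiftOp_swapPoint hm hz hi hj hzi hzj (by omega), shiftOp_comm,
        shiftOp_swapPoint hm' hz hj hi hzj hzi (by rw [simpleOrder_comm]; omega)]
      module

/-- The explicit formula for the defect is valid up to half the order; the reflection principle
supplies the other half. -/
theorem braidDefect_eq_zero_of_swapped (hne : 1 < simpleOrder cs i j) :
    braidDefect cs i j (basisVec z) (simpleOrder cs i j) = 0 := by
  have hm' : 0 < simpleOrder cs j i := by rwa [simpleOrder_comm]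
  have hD := braidDefect_of_swapped hm hz hi hj hzi hzj
  have hS := braidDefect_succ_succ cs i j (basisVec z)
  rcases Nat.even_or_odd' (simpleOrder cs i j) with ⟨n, hn | hn⟩
  · obtain ⟨n, rfl⟩ : ∃ l, n = l + 1 := ⟨n - 1, by omega⟩
    -- For even order the two conjugation chains meet at the midpoint, so the defect vanishes there
    -- and the constant is -v².
    have h0 : braidDefect cs i j (basisVec z) (n + 1) = 0 := by
      rw [hD _ (by omega), (swapPoint_comm_iff cs i j z (n + 1)).2 (dvd_of_eq hn), sub_self]
    have h1 := reflected_sequence_eq_zero (braidDefect_zero cs i j (basisVec z)) hS (n + 1) n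
      (-v ^ 2) (by rw [hS, h0, map_zero]; module) (by rw [h0]; simp)
    rw [hn]
    convert h1 using 2
    ring
  · obtain ⟨n, rfl⟩ : ∃ l, n = l + 1 := ⟨n - 1, by omega⟩
    -- For odd order the symmetric terms cancel in the middle step, leaving the factor v.
    have h0 : braidDefect cs i j (basisVec z) (n + 2) =
        v • braidDefect cs i j (basisVec z) (n + 1) := by
      rw [hS, hD (n + 1) (by omega), hD n (by omega), map_sub,
        shiftOp_swapPoint_last hm hz hi hj hzi hzj (by omega), shiftOp_comm,
        shiftOp_swapPoint_last hm' hz hj hi hzj hzi (by rw [simpleOrder_comm]; omega),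
        (altProd_mul_inv_eq_iff cs i j (n + 2) (n + 1)).2 (by rw [hn]; exact dvd_of_eq (by ring))]
      module
    have h1 := reflected_sequence_eq_zero (braidDefect_zero cs i j (basisVec z)) hS (n + 1)
      (n + 1) v h0 (by rw [h0]; module)
    rw [hn]
    convert h1 using 2
    ring

end Swapped

section Centralized

variable (hm : 0 < simpleOrder cs i j) (hz : z * z = 1)
  (hi : inversionSign cs z (cs.simple i) = 0) (hj : inversionSign cs z (cs.simple j) = 0)
  (hzi : z * cs.simple i = cs.simple i * z) (hzj : z * cs.simple j = cs.simple j * z)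

/-- The involution reached from `z` by one multiplication and `k` conjugations. -/
def fixPoint (cs : CoxeterSystem M W) (i j : B) (z : W) (k : ℕ) : W :=
  altProd cs.simple i j (k + 1) * (altProd cs.simple j i k)⁻¹ * z

include hzi hzj in
theorem mul_letter_of_centralized (k : ℕ) :
    z * cs.simple (letter i j k) = cs.simple (letter i j k) * z := by
  rcases letter_cases i j k with ⟨h1, h2⟩ | ⟨h1, h2⟩ <;> rw [h1] <;> assumption

theorem fixPoint_zero (cs : CoxeterSystem M W) (i j : B) (z : W) :
    fixPoint cs i j z 0 = cs.simple i * z := by simp [fixPoint, altProd_succ]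

theorem fixPoint_comm_iff (cs : CoxeterSystem M W) (i j : B) (z : W) (k : ℕ) :
    fixPoint cs i j z k = fixPoint cs j i z k ↔ simpleOrder cs i j ∣ 2 * k + 1 := by
  rw [fixPoint, fixPoint, mul_left_inj, altProd_mul_inv_eq_iff,
    show k + 1 + k = 2 * k + 1 by ring]

include hm hi hj in
theorem fixPoint_ascent {k : ℕ} (hk : 2 * k + 1 < simpleOrder cs i j) :
    inversionSign cs (fixPoint cs i j z k) (cs.simple (letter j i k)) = 0 := by
  have hp := altProd_mem_dihedral cs i j (k + 1)
  have hq := altProd_mem_dihedral cs j i k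
  rw [dihedral_comm] at hq
  have h := inversionSign_altProd_mul_inv cs i j (k + 1) k (by omega)
  rw [letter_succ] at h
  rw [fixPoint, inversionSign_mul, h, zero_add]
  exact inversionSign_eq_zero_of_minimal cs hm hi hj
    ((isDihedralReflection_comm cs (isDihedralReflection_letter cs j i k)).conj
      (mul_mem hp (inv_mem hq)))

include hzi hzj in
theorem fixPoint_mul_letter (k : ℕ) :
    fixPoint cs i j z k * cs.simple (letter j i k) =
      altProd cs.simple i j (k + 1) * (altProd cs.simple j i (k + 1))⁻¹ * z := by
  rw [fixPoint, mul_assoc, mul_letter_of_centralized hzj hzi, inv_altProd_succ']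
  simp only [mul_assoc]

theorem letter_mul_fixPoint (k : ℕ) :
    cs.simple (letter j i k) * fixPoint cs i j z k =
      altProd cs.simple i j (k + 2) * (altProd cs.simple j i k)⁻¹ * z := by
  rw [fixPoint, altProd_succ _ i j (k + 1), letter_succ]
  simp only [mul_assoc]

include hzi hzj in
theorem fixPoint_commute_iff (k : ℕ) :
    cs.simple (letter j i k) * fixPoint cs i j z k =
      fixPoint cs i j z k * cs.simple (letter j i k) ↔ simpleOrder cs i j ∣ 2 * k + 2 := by
  rw [letter_mul_fixPoint, fixPoint_mul_letter hzi hzj, mul_left_inj,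
    altProd_succ_mul_inv_eq_iff, show k + 1 + k + 1 = 2 * k + 2 by ring]

include hzi hzj in
theorem fixPoint_conj (k : ℕ) :
    cs.simple (letter j i k) * fixPoint cs i j z k * cs.simple (letter j i k) =
      fixPoint cs i j z (k + 1) := by
  rw [mul_assoc, fixPoint_mul_letter hzi hzj, fixPoint, altProd_succ _ i j (k + 1), letter_succ]
  simp only [mul_assoc]

include hz hzi hzj in
theorem fixPoint_mul_self (k : ℕ) : fixPoint cs i j z k * fixPoint cs i j z k = 1 := by
  induction k with
  | zero =>
    rw [fixPoint_zero]
    exact mul_self_of_commute hz hzi.symm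
  | succ k ih =>
    rw [← fixPoint_conj hzi hzj]
    exact mul_self_of_conj ih

include hm hz hi hj hzi hzj

theorem lusztigOp_fixPoint {k : ℕ} (hk : 2 * k + 2 < simpleOrder cs i j) :
    lusztigOp cs (letter j i k) (basisVec (fixPoint cs i j z k)) =
      basisVec (fixPoint cs i j z (k + 1)) ∧
    lusztigOp cs (letter j i k) (basisVec (fixPoint cs i j z (k + 1))) =
      (v ^ 2 - 1) • basisVec (fixPoint cs i j z (k + 1)) +
        v ^ 2 • basisVec (fixPoint cs i j z k) := by
  have h1 := fixPoint_mul_self (cs := cs) hz hzi hzj k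
  have h2 := fixPoint_ascent hm hi hj (k := k) (by omega)
  have h3 : cs.simple (letter j i k) * fixPoint cs i j z k ≠
      fixPoint cs i j z k * cs.simple (letter j i k) := by
    intro h
    rw [fixPoint_commute_iff hzi hzj] at h
    exact absurd (Nat.le_of_dvd (Nat.succ_pos _) h) (by omega)
  rw [← fixPoint_conj hzi hzj k]
  exact ⟨lusztigOp_of_ascent h1 h2 h3, lusztigOp_of_descent h1 h2 h3⟩

theorem lusztigOp_fixPoint_last {k : ℕ} (hk : simpleOrder cs i j = 2 * k + 2) :
    lusztigOp cs (letter j i k) (basisVec (fixPoint cs i j z k)) =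
      v • basisVec (fixPoint cs i j z k) + (v + 1) • basisVec
          (altProd cs.simple i j (k + 2) * (altProd cs.simple j i k)⁻¹ * z) := by
  rw [lusztigOp_of_ascent_commute (fixPoint_mul_self (cs := cs) hz hzi hzj k)
    (fixPoint_ascent hm hi hj (k := k) (by omega))
    ((fixPoint_commute_iff hzi hzj k).2 (by rw [hk])), letter_mul_fixPoint]

theorem shiftOp_fixPoint {k : ℕ} (hk : 2 * k + 4 < simpleOrder cs i j) :
    shiftOp cs i j (basisVec (fixPoint cs i j z (k + 1))) =
      basisVec (fixPoint cs i j z (k + 2)) + v ^ 2 • basisVec (fixPoint cs i j z k) := by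
  have h1 := (lusztigOp_fixPoint hm hz hi hj hzi hzj (k := k) (by omega)).2
  have h2 := (lusztigOp_fixPoint hm hz hi hj hzi hzj (k := k + 1) (by omega)).1
  rw [shiftOp_comm, shiftOp_apply_letter cs j i (k + 1), h2, letter_succ, h1]
  abel

theorem shiftOp_fixPoint_last {k : ℕ} (hk : simpleOrder cs i j = 2 * k + 4) :
    shiftOp cs i j (basisVec (fixPoint cs i j z (k + 1))) =
      v • basisVec (fixPoint cs i j z (k + 1)) + (v + 1) • basisVec
          (altProd cs.simple i j (k + 3) * (altProd cs.simple j i (k + 1))⁻¹ * z) +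
        v ^ 2 • basisVec (fixPoint cs i j z k) := by
  have h1 := (lusztigOp_fixPoint hm hz hi hj hzi hzj (k := k) (by omega)).2
  have h2 := lusztigOp_fixPoint_last hm hz hi hj hzi hzj (k := k + 1) (by omega)
  rw [shiftOp_comm, shiftOp_apply_letter cs j i (k + 1), h2, letter_succ, h1]
  abel

omit hm hj hzj in
theorem lusztigOp_fixPoint_zero :
    lusztigOp cs i (basisVec (fixPoint cs i j z 0)) =
      (v ^ 2 - v - 1) • basisVec (fixPoint cs i j z 0) + (v ^ 2 - v) • basisVec z := by
  rw [fixPoint_zero, lusztigOp_of_descent_commute hz hi hzi.symm]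

omit hm hz hi hj hzi hzj in
theorem shiftOp_apply (x : InvModule W) :
    shiftOp cs i j x = lusztigOp cs i x + lusztigOp cs j x - (v ^ 2 - 1) • x := by
  simp [shiftOp]

/-- The boundary of the chain: descending from s_i z to z is a commuting move, whence the correction
-v. The z term is symmetric and cancels in the defect. -/
theorem shiftOp_fixPoint_zero (hk : 2 < simpleOrder cs i j) :
    shiftOp cs i j (basisVec (fixPoint cs i j z 0)) =
      basisVec (fixPoint cs i j z 1) - v • basisVec (fixPoint cs i j z 0) +
        (v ^ 2 - v) • basisVec z := by
  have h1 := (lusztigOp_fixPoint hm hz hi hj hzi hzj (k := 0) (by omega)).1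
  rw [letter_zero] at h1
  rw [shiftOp_apply, h1, lusztigOp_fixPoint_zero hz hi hzi]
  module

theorem shiftOp_fixPoint_zero_last (hk : simpleOrder cs i j = 2) :
    shiftOp cs i j (basisVec (fixPoint cs i j z 0)) =
      (v + 1) • basisVec (altProd cs.simple i j 2 * z) + (v ^ 2 - v) • basisVec z := by
  have h1 := lusztigOp_fixPoint_last hm hz hi hj hzi hzj (k := 0) (by omega)
  rw [letter_zero, altProd_zero, inv_one, mul_one, zero_add] at h1
  rw [shiftOp_apply, h1, lusztigOp_fixPoint_zero hz hi hzi]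
  module

omit hm in
theorem braidDefect_one_of_centralized :
    braidDefect cs i j (basisVec z) 1 =
      (v + 1) • (basisVec (fixPoint cs i j z 0) - basisVec (fixPoint cs j i z 0)) := by
  rw [braidDefect_one, lusztigOp_of_ascent_commute hz hi hzi.symm,
    lusztigOp_of_ascent_commute hz hj hzj.symm, fixPoint_zero, fixPoint_zero]
  module

/-- Adding v times the previous defect absorbs the boundary correction at s_i z, and the combination
satisfies the same recurrence as the defect itself. -/
theorem braidDefect_of_centralized :
    ∀ k, 2 * k < simpleOrder cs i j →
      braidDefect cs i j (basisVec z) (k + 1) + v • braidDefect cs i j (basisVec z) k =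
      (v + 1) • (basisVec (fixPoint cs i j z k) - basisVec (fixPoint cs j i z k)) := by
  have hm' : 0 < simpleOrder cs j i := by rwa [simpleOrder_comm]
  have h1 := braidDefect_one_of_centralized hz hi hj hzi hzj
  have hS := braidDefect_succ_succ cs i j (basisVec z)
  intro k
  induction k using Nat.strong_induction_on with
  | _ k ih =>
    intro hk
    rcases k with _ | _ | k
    · rw [zero_add, braidDefect_zero, smul_zero, add_zero, h1]
    · rw [zero_add, hS, zero_add, h1, braidDefect_zero, map_smul, map_sub,
        shiftOp_fixPoint_zero hm hz hi hj hzi hzj (by omega), shiftOp_comm,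
        shiftOp_fixPoint_zero hm' hz hj hi hzj hzi (by rw [simpleOrder_comm]; omega)]
      module
    · have e1 := ih (k + 1) (by omega) (by omega)
      have e2 := ih k (by omega) (by omega)
      have e3 : braidDefect cs i j (basisVec z) (k + 3) +
          v • braidDefect cs i j (basisVec z) (k + 2) =
          shiftOp cs i j (braidDefect cs i j (basisVec z) (k + 2) +
            v • braidDefect cs i j (basisVec z) (k + 1)) -
          v ^ 2 • (braidDefect cs i j (basisVec z) (k + 1) +
            v • braidDefect cs i j (basisVec z) k) := by
        rw [map_add, map_smul, hS (k + 1), hS k]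
        module
      rw [e3, e1, e2, map_smul, map_sub, shiftOp_fixPoint hm hz hi hj hzi hzj (by omega),
        shiftOp_comm, shiftOp_fixPoint hm' hz hj hi hzj hzi (by rw [simpleOrder_comm]; omega)]
      module

theorem braidDefect_eq_zero_of_centralized :
    braidDefect cs i j (basisVec z) (simpleOrder cs i j) = 0 := by
  have hm' : 0 < simpleOrder cs j i := by rwa [simpleOrder_comm]
  have hD := braidDefect_of_centralized hm hz hi hj hzi hzj
  have hS := braidDefect_succ_succ cs i j (basisVec z)
  rcases Nat.even_or_odd' (simpleOrder cs i j) with ⟨n, hn | hn⟩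
  · obtain ⟨n, rfl⟩ : ∃ l, n = l + 1 := ⟨n - 1, by omega⟩
    -- With E_k = D_{k+1} + v D_k, the commuting move at the middle gives E_{n+1} = v E_n; the terms
    -- in D_{n+1} cancel and leave v². The order 2 case has no room for this and is computed
    -- directly.
    have h0 : braidDefect cs i j (basisVec z) (n + 2) =
        v ^ 2 • braidDefect cs i j (basisVec z) n := by
      rcases n with _ | n
      · rw [hS, zero_add, braidDefect_one_of_centralized hz hi hj hzi hzj, map_smul, map_sub,
          shiftOp_fixPoint_zero_last hm hz hi hj hzi hzj (by omega), shiftOp_comm,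
          shiftOp_fixPoint_zero_last hm' hz hj hi hzj hzi (by rw [simpleOrder_comm]; omega),
          (altProd_eq_iff cs i j 2).2 (by rw [hn]), braidDefect_zero]
        module
      · have e1 := hD (n + 1) (by omega)
        have e2 := hD n (by omega)
        have e3 : braidDefect cs i j (basisVec z) (n + 3) +
            v • braidDefect cs i j (basisVec z) (n + 2) =
            shiftOp cs i j (braidDefect cs i j (basisVec z) (n + 2) +
              v • braidDefect cs i j (basisVec z) (n + 1)) -
            v ^ 2 • (braidDefect cs i j (basisVec z) (n + 1) +
              v • braidDefect cs i j (basisVec z) n) := by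
          rw [map_add, map_smul, hS (n + 1), hS n]
          module
        have e4 : shiftOp cs i j (braidDefect cs i j (basisVec z) (n + 2) +
              v • braidDefect cs i j (basisVec z) (n + 1)) -
            v ^ 2 • (braidDefect cs i j (basisVec z) (n + 1) +
              v • braidDefect cs i j (basisVec z) n) =
            v • (braidDefect cs i j (basisVec z) (n + 2) +
              v • braidDefect cs i j (basisVec z) (n + 1)) := by
          rw [e1, e2, map_smul, map_sub,
            shiftOp_fixPoint_last hm hz hi hj hzi hzj (by omega), shiftOp_comm,
            shiftOp_fixPoint_last hm' hz hj hi hzj hzi (by rw [simpleOrder_comm]; omega),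
            (altProd_mul_inv_eq_iff cs i j (n + 3) (n + 1)).2
              (by rw [hn]; exact dvd_of_eq (by ring))]
          module
        rw [e4, smul_add, smul_smul, add_comm, add_left_cancel_iff] at e3
        rw [pow_two]
        exact e3
    have h1 := reflected_sequence_eq_zero (braidDefect_zero cs i j (basisVec z)) hS (n + 1) n
      (v ^ 2) h0 rfl
    rw [hn]
    convert h1 using 2
    ring
  -- For odd order the two chains meet, so E_n = 0.
  · have h0 : braidDefect cs i j (basisVec z) (n + 1) =
        (-v) • braidDefect cs i j (basisVec z) n := by
      have h := hD n (by omega)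
      rw [(fixPoint_comm_iff cs i j z n).2 (dvd_of_eq hn), sub_self, smul_zero] at h
      rw [neg_smul]
      exact eq_neg_of_add_eq_zero_left h
    have h1 := reflected_sequence_eq_zero (braidDefect_zero cs i j (basisVec z)) hS n n (-v) h0
      (by rw [h0]; module)
    rw [hn]
    convert h1 using 2
    ring

end Centralized

end Normalizing

/-! ### The braid relation. -/

section Braid

variable {B : Type*} {M : CoxeterMatrix B} {W : Type*} [Group W] (cs : CoxeterSystem M W)

variable {cs} in
theorem lusztigOp_braid_of_minimal {i j : B} {z : W} (hm : 0 < simpleOrder cs i j)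
    (hz : z * z = 1) (hi : inversionSign cs z (cs.simple i) = 0)
    (hj : inversionSign cs z (cs.simple j) = 0) :
    altProd (lusztigOp cs) i j (simpleOrder cs i j) (basisVec z) =
      altProd (lusztigOp cs) j i (simpleOrder cs i j) (basisVec z) := by
  have conj2 : ∀ {x y : W}, z * x * z = y → z * y * z = x := by
    rintro x y rfl
    rw [mul_assoc, mul_assoc, mul_assoc, hz, mul_one, ← mul_assoc, hz, one_mul]
  have hI := isDihedralReflection_left cs i j
  have hJ := isDihedralReflection_right cs i j
  have hc := fun τ => conj_simple_cases cs hm hz hi hj (τ := τ)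
  have he := fun l => conj_simple_eq_of_isDihedralReflection cs hm hz hi hj (l := l)
  by_cases ti : IsDihedralReflection cs i j (z * cs.simple i * z) <;>
  by_cases tj : IsDihedralReflection cs i j (z * cs.simple j * z)
  -- Both simple reflections are sent to simple ones by an injective conjugation, so z either fixes
  -- both or exchanges them.
  · have fixed : ∀ {x y : W}, z * x * z = x → z * y * z = x ∨ z * y * z = y → z * y * z = y := by
      rintro x y hx (hy | hy)
      · have h := conj2 hy
        rw [hx] at h
        rw [← h, hx]
      · exact hy
    by_cases hzi : z * cs.simple i * z = cs.simple i
    · exact sub_eq_zero.1 (braidDefect_eq_zero_of_centralized hm hz hi hj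
        (eq_mul_of_conj hz hzi) (eq_mul_of_conj hz (fixed hzi (he j tj))))
    · have hzj := (he i ti).resolve_left hzi
      refine sub_eq_zero.1 (braidDefect_eq_zero_of_swapped hm hz hi hj
        (eq_mul_of_conj hz hzj) (eq_mul_of_conj hz (conj2 hzj)) ?_)
      have h1 : simpleOrder cs i j ≠ 1 := by
        rw [simpleOrder, Ne, orderOf_eq_one_iff, mul_eq_one_iff_eq_inv, cs.inv_simple]
        intro h
        rw [← h] at hzj
        exact hzi hzj
      omega
  · have hzi : z * cs.simple i * z = cs.simple i := by
      refine (he i ti).resolve_right fun h => tj ?_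
      rw [conj2 h]
      exact hI
    refine lusztigOp_braid_of_one_fixed hm hz hi hj hzi fun τ hτ hτ' => ?_
    rcases hc τ hτ hτ' with h | h | h
    · exact absurd h.2 tj
    · exact h
    · rw [h] at hτ'
      exact absurd hτ' tj
  · have hzj : z * cs.simple j * z = cs.simple j := by
      refine (he j tj).resolve_left fun h => ti ?_
      rw [conj2 h]
      exact hJ
    rw [simpleOrder_comm] at hm ⊢
    refine (lusztigOp_braid_of_one_fixed hm hz hj hi hzj fun τ hτ hτ' => ?_).symm
    have hτ₁ := isDihedralReflection_comm cs hτ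
    have hτ₂ := isDihedralReflection_comm cs hτ'
    rcases hc τ hτ₁ hτ₂ with h | h | h
    · exact absurd h.1 ti
    · rw [h] at hτ₂
      exact absurd hτ₂ ti
    · exact h
  · have hfree : ∀ τ, IsDihedralReflection cs i j τ →
        ¬ IsDihedralReflection cs i j (z * τ * z) := by
      intro τ hτ hτ'
      rcases hc τ hτ hτ' with h | h | h
      · exact ti h.1
      · exact ti (by rwa [h] at hτ')
      · exact tj (by rwa [h] at hτ')
    rw [lusztigOp_altProd_of_free hm hz hi hj hfree le_rfl]
    have h := lusztigOp_altProd_of_free (cs := cs) (i := j) (j := i)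
      (by rwa [simpleOrder_comm]) hz hj hi
      (fun τ hτ hτ' => hfree τ (isDihedralReflection_comm cs hτ)
        (isDihedralReflection_comm cs hτ')) le_rfl
    rw [simpleOrder_comm] at h
    rw [h, (altProd_eq_iff cs i j _).2 dvd_rfl]

theorem v_add_one_ne_zero : v + 1 ≠ 0 := by
  intro h
  have h1 := congrArg (LaurentPolynomial.eval₂ (RingHom.id ℚ) 1) h
  simp [v] at h1

theorem lusztigOp_braid_of_descent {i j : B} {w : W} {m : ℕ} (hw : w * w = 1)
    (h : inversionSign cs w (cs.simple i) = 1)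
    (ih : ∀ u : W, u * u = 1 → cs.length u < cs.length w →
      altProd (lusztigOp cs) i j m (basisVec u) = altProd (lusztigOp cs) j i m (basisVec u)) :
    altProd (lusztigOp cs) i j m (basisVec w) = altProd (lusztigOp cs) j i m (basisVec w) := by
  obtain ⟨u, hu, h0, hlt, ⟨hc, rfl⟩ | ⟨hc, rfl⟩⟩ := exists_ascent_of_descent hw h
  · have h1 := ih u hu hlt
    have h2 := altProd_apply_generator (lusztigOp_mul_self cs i) (lusztigOp_mul_self cs j) h1
    rw [lusztigOp_of_ascent_commute hu h0 hc, map_add, map_add, map_smul, map_smul, map_smul,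
      map_smul, h1] at h2
    -- The relation is known for a_u and for v a_u + (v + 1) a_{su}; cancelling v + 1 in the free
    -- module gives it for a_{su}.
    exact smul_right_injective _ v_add_one_ne_zero (add_left_cancel h2)
  · have h1 := ih u hu hlt
    have h2 := altProd_apply_generator (lusztigOp_mul_self cs i) (lusztigOp_mul_self cs j) h1
    rwa [lusztigOp_of_ascent hu h0 hc] at h2

theorem lusztigOp_braid (i j : B) (hm : 0 < simpleOrder cs i j) :
    altProd (lusztigOp cs) i j (simpleOrder cs i j) =
      altProd (lusztigOp cs) j i (simpleOrder cs i j) := by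
  refine end_ext_a fun w => ?_
  rw [← basisVec_coe]
  have hw : w.1 * w.1 = 1 := by rw [← pow_two, w.2]
  generalize w.1 = w at hw
  induction h : cs.length w using Nat.strong_induction_on generalizing w with
  | _ n ih =>
    subst h
    rcases zmod_two_cases (inversionSign cs w (cs.simple i)) with hi | hi
    · rcases zmod_two_cases (inversionSign cs w (cs.simple j)) with hj | hj
      · exact lusztigOp_braid_of_minimal hm hw hi hj
      · exact (lusztigOp_braid_of_descent cs hw hj
          fun u hu hlt => (ih _ hlt u hu rfl).symm).symm
    · exact lusztigOp_braid_of_descent cs hw hi fun u hu hlt => ih _ hlt u hu rfl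

theorem prod_map_braidWord_lusztigOp (i j : B) :
    ((CoxeterSystem.braidWord M i j).map (lusztigOp cs)).prod =
      ((CoxeterSystem.braidWord M j i).map (lusztigOp cs)).prod := by
  rw [CoxeterSystem.braidWord, CoxeterSystem.braidWord, prod_map_alternatingWord,
    prod_map_alternatingWord, M.symmetric j i]
  rcases Nat.eq_zero_or_pos (M i j) with h | h
  -- An entry 0 means no relation: both braid words are empty.
  · rw [h]; rfl
  · have hd : simpleOrder cs i j ∣ M i j := orderOf_dvd_of_pow_eq_one (cs.simple_mul_simple_pow i j)
    exact (altProd_eq_of_dvd _ (lusztigOp_braid cs i j (Nat.pos_of_dvd_of_pos hd h)) hd).symm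

end Braid

/-! ### The representations, their uniqueness and the extension by σ. -/

section Representations

variable {B : Type*} {M : CoxeterMatrix B} {W : Type*} [Group W] (cs : CoxeterSystem M W)

theorem lusztigOp_respects ⦃x y : FreeAlgebra Scalars B⦄ (h : HeckeRel M x y) :
    FreeAlgebra.lift Scalars (lusztigOp cs) x = FreeAlgebra.lift Scalars (lusztigOp cs) y := by
  induction h with
  | quadratic i =>
    rw [map_mul, map_sub, map_add, AlgHom.commutes, FreeAlgebra.lift_ι_apply, map_one, map_zero]
    exact sub_mul_add_one_eq_zero (A := Module.End Scalars (InvModule W)) (lusztigOp_mul_self cs i)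
  | braid i j =>
    have key : ∀ l : List B, FreeAlgebra.lift Scalars (lusztigOp cs)
        (l.map (FreeAlgebra.ι Scalars)).prod = (l.map (lusztigOp cs)).prod := by
      intro l
      rw [map_list_prod, List.map_map]
      congr 1
      exact List.map_congr_left fun i _ => FreeAlgebra.lift_ι_apply _ i
    rw [key, key, prod_map_braidWord_lusztigOp]

/-- Lusztig's representation of the Hecke algebra on the free module on involutions. -/
def lusztigRep : Hecke M →ₐ[Scalars] Module.End Scalars (InvModule W) :=
  RingQuot.liftAlgHom Scalars ⟨FreeAlgebra.lift Scalars (lusztigOp cs), lusztigOp_respects cs⟩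

theorem lusztigRep_T (i : B) : lusztigRep cs (Hecke.T M i) = lusztigOp cs i := by
  rw [lusztigRep, Hecke.T, RingQuot.liftAlgHom_mkAlgHom_apply, FreeAlgebra.lift_ι_apply]

theorem isLusztigRep_lusztigRep : IsLusztigRep cs (lusztigRep cs) := fun i w => by
  rw [lusztigRep_T, lusztigOp_a]

variable {cs}

theorem IsLusztigRep.apply_T {R : Hecke M →ₐ[Scalars] Module.End Scalars (InvModule W)}
    (hR : IsLusztigRep cs R) (i : B) : R (Hecke.T M i) = lusztigOp cs i :=
  end_ext_a fun w => by rw [hR i w, lusztigOp_a]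

theorem IsLusztigRep.eq_lusztigRep {R : Hecke M →ₐ[Scalars] Module.End Scalars (InvModule W)}
    (hR : IsLusztigRep cs R) : R = lusztigRep cs := by
  refine RingQuot.ringQuot_ext' _ _ _ (FreeAlgebra.hom_ext (funext fun i => ?_))
  exact (hR.apply_T i).trans (lusztigRep_T cs i).symm

theorem length_apply_le {σ : MulAut W} (hσ : ∀ i, ∃ j, σ (cs.simple i) = cs.simple j) (w : W) :
    cs.length (σ w) ≤ cs.length w := by
  choose f hf using hσ
  obtain ⟨ω, hω, rfl⟩ := cs.exists_isReduced w
  have h : σ (cs.wordProd ω) = cs.wordProd (ω.map f) := by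
    rw [CoxeterSystem.wordProd, CoxeterSystem.wordProd, map_list_prod, List.map_map, List.map_map]
    congr 1
    exact List.map_congr_left fun i _ => hf i
  rw [h, hω.eq]
  exact (cs.length_wordProd_le _).trans_eq (List.length_map f)

/-- σ carries words in the simple reflections to words of the same length, and so does its inverse.
-/
theorem length_apply {σ : MulAut W} (hσ : σ '' Set.range cs.simple = Set.range cs.simple) (w : W) :
    cs.length (σ w) = cs.length w := by
  refine le_antisymm (length_apply_le (fun i => ?_) w) ?_
  · obtain ⟨j, hj⟩ : σ (cs.simple i) ∈ Set.range cs.simple :=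
      hσ ▸ Set.mem_image_of_mem σ (Set.mem_range_self i)
    exact ⟨j, hj.symm⟩
  · have h := length_apply_le (cs := cs) (σ := σ⁻¹) (fun i => ?_) (σ w)
    · rwa [MulAut.inv_apply_self] at h
    · obtain ⟨_, ⟨j, rfl⟩, hj⟩ : cs.simple i ∈ σ '' Set.range cs.simple :=
        hσ.symm ▸ Set.mem_range_self i
      exact ⟨j, by rw [← hj, MulAut.inv_apply_self]⟩

/-- The permutation of the basis induced by an automorphism. -/
def sigmaOp (σ : MulAut W) : Module.End Scalars (InvModule W) :=
  Finsupp.lmapDomain Scalars Scalars (autInv σ)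

theorem sigmaOp_a (σ : MulAut W) (w : Involutions W) : sigmaOp σ (a w) = a (autInv σ w) := by
  simp [sigmaOp, a]

theorem sigmaOp_basisVec (σ : MulAut W) {w : W} (hw : w * w = 1) :
    sigmaOp σ (basisVec w) = basisVec (σ w) := by
  rw [basisVec_eq (by rwa [pow_two]), sigmaOp_a, ← basisVec_coe]
  rfl

theorem sigmaOp_mul (σ τ : MulAut W) : sigmaOp (σ * τ) = sigmaOp σ * sigmaOp τ :=
  end_ext_a fun w => by
    rw [Module.End.mul_apply, sigmaOp_a, sigmaOp_a, sigmaOp_a]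
    rfl

theorem sigmaOp_one : sigmaOp (1 : MulAut W) = 1 :=
  end_ext_a fun w => by
    rw [sigmaOp_a]
    rfl

theorem sigmaOp_pow (σ : MulAut W) (n : ℕ) : sigmaOp (σ ^ n) = sigmaOp σ ^ n := by
  induction n with
  | zero => rw [pow_zero, pow_zero, sigmaOp_one]
  | succ n ih => rw [pow_succ, pow_succ, sigmaOp_mul, ih]

/-- Each case of Lusztig's formula depends only on commutation with s and on a comparison of
lengths, both of which σ transports to σ(s) and σ(w). -/
theorem sigmaOp_mul_lusztigOp {σ : MulAut W}
    (hσ : σ '' Set.range cs.simple = Set.range cs.simple) {i j : B}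
    (hij : σ (cs.simple i) = cs.simple j) :
    sigmaOp σ * lusztigOp cs i = lusztigOp cs j * sigmaOp σ := by
  refine end_ext_a fun w => ?_
  have hw : w.1 * w.1 = 1 := by rw [← pow_two, w.2]
  rw [← basisVec_coe, Module.End.mul_apply, Module.End.mul_apply, sigmaOp_basisVec σ hw]
  generalize w.1 = w at hw
  have hsq : ∀ {u : W}, u * u = 1 → σ u * σ u = 1 := fun {u} hu => by
    rw [← map_mul, hu, map_one]
  have hasc : ∀ {u : W}, inversionSign cs u (cs.simple i) = 0 →
      inversionSign cs (σ u) (cs.simple j) = 0 := fun {u} hu => by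
    rw [inversionSign_eq_zero_iff cs (cs.isReflection_simple _)] at hu ⊢
    rwa [← hij, ← map_mul, length_apply hσ, length_apply hσ]
  have hcomm : ∀ {u : W}, cs.simple j * σ u = σ u * cs.simple j ↔
      cs.simple i * u = u * cs.simple i := fun {u} => by
    rw [← hij, ← map_mul, ← map_mul, σ.injective.eq_iff]
  rcases zmod_two_cases (inversionSign cs w (cs.simple i)) with h | h
  · by_cases hc : cs.simple i * w = w * cs.simple i
    · rw [lusztigOp_of_ascent_commute hw h hc,
        lusztigOp_of_ascent_commute (hsq hw) (hasc h) (hcomm.2 hc), map_add, map_smul, map_smul,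
        sigmaOp_basisVec σ hw, sigmaOp_basisVec σ (mul_self_of_commute hw hc), map_mul, hij]
    · rw [lusztigOp_of_ascent hw h hc,
        lusztigOp_of_ascent (hsq hw) (hasc h) (mt hcomm.1 hc),
        sigmaOp_basisVec σ (mul_self_of_conj hw), map_mul, map_mul, hij]
  · obtain ⟨u, hu, h0, -, ⟨hc, rfl⟩ | ⟨hc, rfl⟩⟩ := exists_ascent_of_descent hw h
    · rw [lusztigOp_of_descent_commute hu h0 hc, map_mul, hij,
        lusztigOp_of_descent_commute (hsq hu) (hasc h0) (hcomm.2 hc), map_add, map_smul, map_smul,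
        sigmaOp_basisVec σ hu, sigmaOp_basisVec σ hw, map_mul, hij]
    · rw [lusztigOp_of_descent hu h0 hc, map_mul, map_mul, hij,
        lusztigOp_of_descent (hsq hu) (hasc h0) (mt hcomm.1 hc), map_add, map_smul, map_smul,
        sigmaOp_basisVec σ hu, sigmaOp_basisVec σ hw, map_mul, map_mul, hij]

/-- The images of the generators of the extended Hecke algebra. -/
def extendedGenerator (R : Hecke M →ₐ[Scalars] Module.End Scalars (InvModule W)) (σ : MulAut W) :
    Option (Hecke M) → Module.End Scalars (InvModule W)
  | none => sigmaOp σ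
  | some h => R h

theorem extendedGenerator_respects {R : Hecke M →ₐ[Scalars] Module.End Scalars (InvModule W)}
    (hR : IsLusztigRep cs R) {σ : MulAut W}
    (hσ : σ '' Set.range cs.simple = Set.range cs.simple)
    ⦃x y : FreeAlgebra Scalars (Option (Hecke M))⦄ (h : ExtendedHeckeRel cs σ x y) :
    FreeAlgebra.lift Scalars (extendedGenerator R σ) x =
      FreeAlgebra.lift Scalars (extendedGenerator R σ) y := by
  induction h with
  | add x y => simp [extendedGenerator]
  | mul x y => simp [extendedGenerator]
  | scalar r => simp [extendedGenerator]
  | sigma_pow =>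
    rw [map_pow, FreeAlgebra.lift_ι_apply, map_one, extendedGenerator, ← sigmaOp_pow,
      pow_orderOf_eq_one, sigmaOp_one]
  | sigma_simple i j hij =>
    rw [map_mul, map_mul, FreeAlgebra.lift_ι_apply, FreeAlgebra.lift_ι_apply,
      FreeAlgebra.lift_ι_apply, extendedGenerator, extendedGenerator, extendedGenerator,
      hR.apply_T, hR.apply_T, sigmaOp_mul_lusztigOp hσ hij]

theorem existsUnique_extension {R : Hecke M →ₐ[Scalars] Module.End Scalars (InvModule W)}
    (hR : IsLusztigRep cs R) {σ : MulAut W}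
    (hσ : σ '' Set.range cs.simple = Set.range cs.simple) :
    ∃! R' : ExtendedHecke cs σ →ₐ[Scalars] Module.End Scalars (InvModule W),
      (∀ h : Hecke M, R' (ExtendedHecke.incl cs σ h) = R h) ∧
        ∀ w : Involutions W, R' (ExtendedHecke.Tσ cs σ) (a w) = a (autInv σ w) := by
  refine ⟨RingQuot.liftAlgHom Scalars ⟨FreeAlgebra.lift Scalars (extendedGenerator R σ),
    extendedGenerator_respects hR hσ⟩, ⟨fun h => ?_, fun w => ?_⟩, ?_⟩
  · change RingQuot.liftAlgHom Scalars _ (RingQuot.mkAlgHom Scalars (ExtendedHeckeRel cs σ) _) = _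
    rw [RingQuot.liftAlgHom_mkAlgHom_apply, FreeAlgebra.lift_ι_apply, extendedGenerator]
  · rw [ExtendedHecke.Tσ, RingQuot.liftAlgHom_mkAlgHom_apply, FreeAlgebra.lift_ι_apply,
      extendedGenerator, sigmaOp_a]
  · rintro R' ⟨h1, h2⟩
    -- The extended algebra is generated by the image of the Hecke algebra and T_σ, and both
    -- conditions on the extension prescribe its values there.
    refine RingQuot.ringQuot_ext' _ _ _ (FreeAlgebra.hom_ext (funext fun o => ?_))
    rw [Function.comp_apply, Function.comp_apply, AlgHom.comp_apply, AlgHom.comp_apply,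
      RingQuot.liftAlgHom_mkAlgHom_apply, FreeAlgebra.lift_ι_apply]
    rcases o with _ | h
    · exact end_ext_a fun w => (h2 w).trans (sigmaOp_a σ w).symm
    · exact h1 h

end Representations

end

end TwistedInvolution

theorem proposition2p3 {B : Type*} {M : CoxeterMatrix B} {W : Type*} [Group W] [Finite W]
    (cs : CoxeterSystem M W) (σ : MulAut W)
    (hσ : σ '' Set.range cs.simple = Set.range cs.simple) :
    (∃! R : TwistedInvolution.Hecke M →ₐ[TwistedInvolution.Scalars]
        Module.End TwistedInvolution.Scalars (TwistedInvolution.InvModule W),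
      TwistedInvolution.IsLusztigRep cs R) ∧
    ∀ R : TwistedInvolution.Hecke M →ₐ[TwistedInvolution.Scalars]
        Module.End TwistedInvolution.Scalars (TwistedInvolution.InvModule W),
      TwistedInvolution.IsLusztigRep cs R →
      ∃! R' : TwistedInvolution.ExtendedHecke cs σ →ₐ[TwistedInvolution.Scalars]
          Module.End TwistedInvolution.Scalars (TwistedInvolution.InvModule W),
        (∀ h : TwistedInvolution.Hecke M,
          R' (TwistedInvolution.ExtendedHecke.incl cs σ h) = R h) ∧
        ∀ w : TwistedInvolution.Involutions W,
          R' (TwistedInvolution.ExtendedHecke.Tσ cs σ) (TwistedInvolution.a w) =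
            TwistedInvolution.a (TwistedInvolution.autInv σ w) :=
  ⟨⟨TwistedInvolution.lusztigRep cs, TwistedInvolution.isLusztigRep_lusztigRep cs,
    fun _ hR => hR.eq_lusztigRep⟩,
    fun _ hR => TwistedInvolution.existsUnique_extension hR hσ⟩
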